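/- For a set $X$ write $X^{[2]}=X^4$ and $X^{[3]}=X^8$, with coordinates indexed by $\{0,1\}^2$ and $\{0,1\}^3$ in lexicographic order, so that $X^{[3]}=X^{[2]}\times X^{[2]}$ (the faces $\epsilon_1=0$ and $\epsilon_1=1$). A \emph{weak parallelogram structure} on a nonempty set $X$ is a set $\mathcal P\subset X^{[2]}$ such that (i) the relation $(x_{00},x_{01})\sim(x_{10},x_{11})\iff (x_{00},x_{01},x_{10},x_{11})\in\mathcal P$ is an equivalence relation on $X^2$; (ii) $(x_{00},x_{01},x_{10},x_{11})\in\mathcal P$ implies $(x_{00},x_{10},x_{01},x_{11})\in\mathcal P$; (iii) for all $x_{00},x_{01},x_{10}\in X$ there is $x_{11}\in X$ with $(x_{00},x_{01},x_{10},x_{11})\in\mathcal P$. Its \emph{base} is $B=X^2/\!\sim$, and, after the choice of a point $i\in X$, the projection $\pi_B\colon X\to B$ sends $x$ to the class of $(i,x)$. A \emph{strong parallelepiped structure} on $X$ is a pair $(\mathcal P,\mathcal Q)$ with $\mathcal P$ a weak parallelogram structure on $X$ and $\mathcal Q\subset X^{[3]}$ such that (i) every two-dimensional face of every element of $\mathcal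 Q$ is in $\mathcal P$; (ii) $\mathcal Q$ is invariant under the permutations of coordinates induced by the Euclidean isometries of the cube; (iii) the relation $\mathbf x'\approx\mathbf x''\iff(\mathbf x',\mathbf x'')\in\mathcal Q$ is an equivalence relation on $\mathcal P$; (iv) whenever $x_{000},\dots,x_{110}\in X$ are seven points with $(x_{000},x_{001},x_{010},x_{011})$, $(x_{000},x_{010},x_{100},x_{110})$ and $(x_{000},x_{001},x_{100},x_{101})$ in $\mathcal P$, there is exactly one $x_{111}\in X$ with $(x_{000},\dots,x_{110},x_{111})\in\mathcal Q$. Let $G$ be a group with commutator subgroup $G_2$ and center $Z(G)$, and let $F,\Gamma$ be subgroups of $G$ with $G_2\subset F\subset Z(G)$ and $\Gamma\cap F=\{1\}$. Let $G^{[2,1]}\subset G^{[2]}$ be the subgroup generated by the elements $(g,g,1,1)$, $(g,1,g,1)$, $(g,g,g,g)$ with $g\in G$; let $G^{[3,2]}\subset G^{[3]}$ be generated by the elements equal to some $g\in G$ on a face of $\{0,1\}^3$ and to $1$ elsewhere; and let $F^{[3,1]}\subset G^{[3]}$ be generated by the elements equal to some $u\in F$ on an edge of $\{0,1\}^3$ and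 to $1$ elsewhere. The images of $G^{[2,1]}F^{[2]}$ and $G^{[3,2]}F^{[3,1]}$ in $(G/\Gamma)^{[2]}$ and $(G/\Gamma)^{[3]}$ form a strong parallelepiped structure on $G/\Gamma$; the structures obtained in this way are called \emph{nilparallelepiped structures}. \textbf{Theorem.} Every strong parallelepiped structure $(\mathcal P,\mathcal Q)$ on a nonempty set $X$ can be embedded in a nilparallelepiped structure. That is, there are a group $G$ and subgroups $F,\Gamma$ as above, with associated nilparallelepiped structure $(\mathcal P',\mathcal Q')$ on $Z=G/\Gamma$, and an injective map $\varphi\colon X\to Z$ with image $Y$, such that, coordinatewise, $\varphi$ carries $\mathcal P$ onto $\mathcal P'\cap Y^{[2]}$ and $\mathcal Q$ onto $\mathcal Q'\cap Y^{[3]}$, the restriction to $Y$ of the projection of $Z$ onto the base of $\mathcal P'$ is onto, and for every $\mathbf x\in\mathcal Q'$ whose seven coordinates $x_{000},\dots,x_{110}$ lie in $Y$, also $x_{111}\in Y$. -/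

import Mathlib

open scoped Pointwise

universe u

namespace HKPar

/-- `X^[n]`: families of points of `X` indexed by the vertices of the unit cube `{0,1}^n`.
The vertex `ε₁ε₂…εₙ` is the function `Fin n → Bool` with values `ε₁, ε₂, …, εₙ`
(`false` is `0`, `true` is `1`). -/
abbrev Cube (n : ℕ) (X : Type u) : Type u := (Fin n → Bool) → X

/-- The point `(x₀₀, x₀₁, x₁₀, x₁₁)` of `X^[2]`. -/
def quad {X : Type u} (x00 x01 x10 x11 : X) : Cube 2 X := fun ε =>
  match ε 0, ε 1 with
  | false, false => x00
  | false, true => x01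
  | true, false => x10
  | true, true => x11

/-- The point `(x', x'')` of `X^[n+1] = X^[n] × X^[n]`: its face `ε₁ = 0` is `x'` and its
face `ε₁ = 1` is `x''`. -/
def glue {X : Type u} {n : ℕ} (x' x'' : Cube n X) : Cube (n + 1) X := fun ε =>
  if ε 0 = true then x'' (fun i => ε i.succ) else x' (fun i => ε i.succ)

/-- The point `(x₀₀₀, x₀₀₁, x₀₁₀, x₀₁₁, x₁₀₀, x₁₀₁, x₁₁₀, x₁₁₁)` of `X^[3]`. -/
def oct {X : Type u} (x000 x001 x010 x011 x100 x101 x110 x111 : X) : Cube 3 X :=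
  glue (quad x000 x001 x010 x011) (quad x100 x101 x110 x111)

/-- The face `{ε : ε i = b}` of a point of `X^[n+1]`, seen as a point of `X^[n]`; the vertices of
the face are listed in increasing lexicographic order. -/
def face {X : Type u} {n : ℕ} (i : Fin (n + 1)) (b : Bool) (x : Cube (n + 1) X) : Cube n X :=
  fun ε => x (Fin.insertNth (α := fun _ => Bool) i b ε)

/-- Permutations of the vertices of the cube that are induced by Euclidean isometries of the
cube: those that preserve distances between vertices (on `{0,1}^n` the Hamming distance is the
square of the Euclidean distance). -/
def IsEuclidean {n : ℕ} (σ : Equiv.Perm (Fin n → Bool)) : Prop :=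
  ∀ a b : Fin n → Bool, hammingDist (σ a) (σ b) = hammingDist a b

/-- The relation `∼` on `X²` attached to a set `P` of parallelograms. -/
def ParRel {X : Type u} (P : Set (Cube 2 X)) (p q : X × X) : Prop :=
  quad p.1 p.2 q.1 q.2 ∈ P

/-- Weak parallelogram structures. -/
structure IsWeakParallelogramStructure {X : Type u} (P : Set (Cube 2 X)) : Prop where
  equivalence : Equivalence (ParRel P)
  symmetry : ∀ x00 x01 x10 x11 : X, quad x00 x01 x10 x11 ∈ P → quad x00 x10 x01 x11 ∈ P
  closing : ∀ x00 x01 x10 : X, ∃ x11 : X, quad x00 x01 x10 x11 ∈ P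

/-- The base `B = X²/∼` of a parallelogram structure. -/
def Base {X : Type u} (P : Set (Cube 2 X)) : Type u := Quot (ParRel P)

/-- The projection `π : X → B`, `π(x) = ⟨i, x⟩`, attached to the choice of a point `i` of `X`. -/
def baseProj {X : Type u} (P : Set (Cube 2 X)) (i : X) (x : X) : Base P :=
  Quot.mk (ParRel P) (i, x)

/-- Weak parallelepiped structures `(P, Q)`. -/
structure IsWeakParallelepipedStructure {X : Type u}
    (P : Set (Cube 2 X)) (Q : Set (Cube 3 X)) : Prop where
  parallelograms : IsWeakParallelogramStructure P
  faces : ∀ x ∈ Q, ∀ (i : Fin 3) (b : Bool), face i b x ∈ P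
  symmetries : ∀ σ : Equiv.Perm (Fin 3 → Bool), IsEuclidean σ → ∀ x ∈ Q, (fun ε => x (σ ε)) ∈ Q
  equivalence : Equivalence (fun x' x'' : P => glue (x' : Cube 2 X) (x'' : Cube 2 X) ∈ Q)
  closing : ∀ x000 x001 x010 x011 x100 x101 x110 : X,
    quad x000 x001 x010 x011 ∈ P → quad x000 x010 x100 x110 ∈ P → quad x000 x001 x100 x101 ∈ P →
      ∃ x111 : X, oct x000 x001 x010 x011 x100 x101 x110 x111 ∈ Q

/-- Strong parallelepiped structures: the closing point is unique. -/
structure IsStrongParallelepipedStructure {X : Type u}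
    (P : Set (Cube 2 X)) (Q : Set (Cube 3 X)) : Prop
    extends IsWeakParallelepipedStructure P Q where
  unique : ∀ x000 x001 x010 x011 x100 x101 x110 : X,
    quad x000 x001 x010 x011 ∈ P → quad x000 x010 x100 x110 ∈ P → quad x000 x001 x100 x101 ∈ P →
      ∀ y z : X, oct x000 x001 x010 x011 x100 x101 x110 y ∈ Q →
        oct x000 x001 x010 x011 x100 x101 x110 z ∈ Q → y = z

/-- `φ : X → Z` is an isomorphism of `(X, P, Q)` onto a structure that is embedded in
`(Z, P', Q')`: it is a bijection of `X` onto a subset `Y` of `Z`, it carries `P` to `P' ∩ Y^[2]`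
and `Q` to `Q' ∩ Y^[3]`, the projection of `Z` to its base is onto when restricted to `Y`, and `Y`
contains the last vertex of every parallelepiped of `Z` whose other seven vertices lie in `Y`. -/
structure IsParallelepipedEmbedding {X Z : Type u} (P : Set (Cube 2 X)) (Q : Set (Cube 3 X))
    (P' : Set (Cube 2 Z)) (Q' : Set (Cube 3 Z)) (φ : X → Z) : Prop where
  injective : Function.Injective φ
  map_parallelograms : ∀ x : Cube 2 X, x ∈ P ↔ (fun ε => φ (x ε)) ∈ P'
  map_parallelepipeds : ∀ x : Cube 3 X, x ∈ Q ↔ (fun ε => φ (x ε)) ∈ Q'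
  base_onto : ∀ (i : Z) (b : Base P'), ∃ y ∈ Set.range φ, baseProj P' i y = b
  closed : ∀ x ∈ Q', (∀ ε : Fin 3 → Bool, ε ≠ (fun _ => true) → x ε ∈ Set.range φ) →
    x (fun _ => true) ∈ Set.range φ

section Groups

variable {G : Type u} [Group G]

open Classical in
/-- The element of `G^[n]` with `g` at the vertices of `α` and `1` elsewhere. -/
noncomputable def place {n : ℕ} (α : Set (Fin n → Bool)) (g : G) : Cube n G :=
  fun ε => if ε ∈ α then g else 1

variable (G) in
/-- The two dimensional edge group `G^[2,1]`. -/
def edgeGroup2 : Subgroup (Cube 2 G) :=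
  Subgroup.closure {x | ∃ g : G, x = quad g g 1 1 ∨ x = quad g 1 g 1 ∨ x = quad g g g g}

/-- The three dimensional edge group `F^[3,1]` of a subgroup `F` of `G`, as a subgroup of `G^[3]`;
an edge is a pair of vertices that differ in exactly one coordinate. -/
def edgeGroup3 (F : Subgroup G) : Subgroup (Cube 3 G) :=
  Subgroup.closure {x | ∃ g ∈ F, ∃ a b : Fin 3 → Bool, hammingDist a b = 1 ∧ x = place {a, b} g}

variable (G) in
/-- The three dimensional face group `G^[3,2]`. -/
def faceGroup3 : Subgroup (Cube 3 G) :=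
  Subgroup.closure {x | ∃ (g : G) (i : Fin 3) (b : Bool), x = place {ε | ε i = b} g}

/-- The hypotheses `G₂ ⊆ F ⊆ Z(G)` and `Γ ∩ F = {1}` under which `G`, `F`, `Γ` define a
nilparallelepiped structure on `G/Γ`. -/
structure IsNilTriple (F Γ : Subgroup G) : Prop where
  commutator_le : commutator G ≤ F
  le_center : F ≤ Subgroup.center G
  inf_eq_bot : Γ ⊓ F = ⊥

/-- The set of parallelograms `π^[2](G^[2,1] F^[2])` of `G/Γ`. -/
def nilParallelograms (F Γ : Subgroup G) : Set (Cube 2 (G ⧸ Γ)) :=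
  (fun (g : Cube 2 G) (ε : Fin 2 → Bool) => (g ε : G ⧸ Γ)) ''
    ((edgeGroup2 G : Set (Cube 2 G)) * {f : Cube 2 G | ∀ ε, f ε ∈ F})

/-- The set of parallelepipeds `π^[3](G^[3,2] F^[3,1])` of `G/Γ`. -/
def nilParallelepipeds (F Γ : Subgroup G) : Set (Cube 3 (G ⧸ Γ)) :=
  (fun (g : Cube 3 G) (ε : Fin 3 → Bool) => (g ε : G ⧸ Γ)) ''
    ((faceGroup3 G : Set (Cube 3 G)) * (edgeGroup3 F : Set (Cube 3 G)))

end Groups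

/-- `(P, Q)` is a nilparallelepiped structure on `G/Γ`: a strong parallelepiped structure that is
defined by a triple `G`, `F`, `Γ`. -/
structure IsNilParallelepipedStructure {G : Type u} [Group G] (F Γ : Subgroup G)
    (P : Set (Cube 2 (G ⧸ Γ))) (Q : Set (Cube 3 (G ⧸ Γ))) : Prop where
  triple : IsNilTriple F Γ
  parallelograms_eq : P = nilParallelograms F Γ
  parallelepipeds_eq : Q = nilParallelepipeds F Γ
  strong : IsStrongParallelepipedStructure P Q

end HKPar

/-!
# Strong parallelepiped structures embed in nilparallelepiped structures

Let `(P, Q)` be a strong parallelepiped structure on `X`. Call a permutation of `X` a *face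
translation* (an *edge translation*) if its action on any face (any edge) preserves `Q`. A face
meets a second face in an edge and an edge in a vertex, and a permutation that acts on one vertex
and preserves `Q` is trivial because the last vertex of a parallelepiped is determined by the
others. Hence commutators of face translations are edge translations, and edge translations commute
with face translations: for every strong structure, the group `G` of face translations, its subgroup
`A` of edge translations and the stabilizer `Γ` of a point satisfy `G₂ ⊆ A ⊆ Z(G)` and `Γ ∩ A = 1`.
Gluing parallelepipeds shows that `A` acts simply transitively on the fibres of the projection to
the base (`exists_mem_edgeTranslations`). If `G` acts transitively on `X`, then
`X` is `G ⧸ Γ`, and `P`, `Q` are the nilparallelograms and nilparallelepipeds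
(`exists_isNilParallelepipedStructure`).

In general `G` is not transitive, and `X` has to be enlarged. The base of `P` is an abelian group
`B`, and `P` is the preimage of the quadruples with `b₀₀ + b₁₁ = b₀₁ + b₁₀`
(`IsWeakParallelogramStructure.exists_addCommGroup`). The group `A` of edge translations of `X` is
embedded in an injective abelian group `F`. After the choice of a point in each fibre, `X` becomes a
subset of `B × F`, and membership of a point of `X^[3]` in `Q` depends only on its projection to the
base and on the alternating sum of its fibre coordinates (`oct_apply_mem_iff`). The same rule
defines a strong parallelepiped structure on `B × F`, in which `X` is embedded (`isStrong_prod`,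
`isParallelepipedEmbedding`).

It remains to see that the face translations of `B × F` act transitively, that is, that every
translation by `b` of the base lifts to a face translation `(c, f) ↦ (c + b, f + φ c)`. The
condition on `φ` is that its alternating sum over each parallelogram `c` has a value prescribed by
the parallelepipeds with faces `c` and `c + b`. These prescribed values define another weak
parallelogram structure on `B × F`; its base is an abelian group that contains `F`, and a retraction
onto the injective group `F` provides `φ` (`exists_lift_translation`).
-/

namespace HKPar

open scoped commutatorElement

/-! ### Vertices, faces and isometries of cubes -/

theorem eq_quad {X : Type u} (x : Cube 2 X) :
    x = quad (x ![false, false]) (x ![false, true]) (x ![true, false]) (x ![true, true]) := by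
  funext ε
  have h : ε = ![ε 0, ε 1] := by ext i; fin_cases i <;> rfl
  rw [h]
  generalize ε 0 = b0
  generalize ε 1 = b1
  cases b0 <;> cases b1 <;> rfl

theorem exists_eq_quad {X : Type u} (x : Cube 2 X) : ∃ a b c d, x = quad a b c d :=
  ⟨_, _, _, _, eq_quad x⟩

theorem eq_oct {X : Type u} (x : Cube 3 X) :
    x = oct (x ![false, false, false]) (x ![false, false, true]) (x ![false, true, false])
      (x ![false, true, true]) (x ![true, false, false]) (x ![true, false, true])
      (x ![true, true, false]) (x ![true, true, true]) := by
  funext ε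
  have h : ε = ![ε 0, ε 1, ε 2] := by ext i; fin_cases i <;> rfl
  rw [h]
  generalize ε 0 = b0
  generalize ε 1 = b1
  generalize ε 2 = b2
  cases b0 <;> cases b1 <;> cases b2 <;> rfl

theorem exists_eq_oct {X : Type u} (x : Cube 3 X) :
    ∃ a b c d a' b' c' d', x = oct a b c d a' b' c' d' :=
  ⟨_, _, _, _, _, _, _, _, eq_oct x⟩

theorem exists_eq_glue {X : Type u} {n : ℕ} (x : Cube (n + 1) X) :
    ∃ x' x'' : Cube n X, x = glue x' x'' := by
  refine ⟨fun ε => x (Fin.cons false ε), fun ε => x (Fin.cons true ε), ?_⟩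
  funext ε
  unfold glue
  have h : ε = Fin.cons (ε 0) (fun i => ε i.succ) := (Fin.cons_self_tail ε).symm
  conv_lhs => rw [h]
  split_ifs with h0
  · rw [h0]
  · rw [Bool.not_eq_true] at h0
    rw [h0]

theorem apply_quad {X Y : Type u} (f : (Fin 2 → Bool) → X → Y) (a b c d : X) :
    (fun ε => f ε (quad a b c d ε)) = quad (f ![false, false] a) (f ![false, true] b)
      (f ![true, false] c) (f ![true, true] d) :=
  eq_quad _

theorem comp_quad {X Y : Type u} (f : X → Y) (a b c d : X) :
    (fun ε => f (quad a b c d ε)) = quad (f a) (f b) (f c) (f d) :=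
  apply_quad (fun _ => f) a b c d

theorem apply_oct {X Y : Type u} (f : (Fin 3 → Bool) → X → Y) (a b c d a' b' c' d' : X) :
    (fun ε => f ε (oct a b c d a' b' c' d' ε)) =
      oct (f ![false, false, false] a) (f ![false, false, true] b) (f ![false, true, false] c)
        (f ![false, true, true] d) (f ![true, false, false] a') (f ![true, false, true] b')
        (f ![true, true, false] c') (f ![true, true, true] d') :=
  eq_oct _

theorem comp_glue {X Y : Type u} {n : ℕ} (f : X → Y) (x' x'' : Cube n X) :
    (fun ε => f (glue x' x'' ε)) = glue (fun ε => f (x' ε)) (fun ε => f (x'' ε)) := by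
  funext ε
  unfold glue
  split_ifs <;> rfl

theorem comp_oct {X Y : Type u} (f : X → Y) (a b c d a' b' c' d' : X) :
    (fun ε => f (oct a b c d a' b' c' d' ε)) =
      oct (f a) (f b) (f c) (f d) (f a') (f b') (f c') (f d') :=
  apply_oct (fun _ => f) a b c d a' b' c' d'

theorem const_eq_quad {X : Type u} (x : X) : (fun _ => x : Cube 2 X) = quad x x x x :=
  eq_quad _

theorem const_eq_oct {X : Type u} (x : X) : (fun _ => x : Cube 3 X) = oct x x x x x x x x :=
  eq_oct _

theorem glue_inj {X : Type u} {n : ℕ} {x' x'' y' y'' : Cube n X} :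
    glue x' x'' = glue y' y'' ↔ x' = y' ∧ x'' = y'' := by
  refine ⟨fun h => ⟨?_, ?_⟩, fun h => by rw [h.1, h.2]⟩
  · funext ε
    simpa [glue] using congrFun h (Fin.cons false ε)
  · funext ε
    simpa [glue] using congrFun h (Fin.cons true ε)

theorem quad_inj {X : Type u} {a b c d a' b' c' d' : X} :
    quad a b c d = quad a' b' c' d' ↔ a = a' ∧ b = b' ∧ c = c' ∧ d = d' := by
  refine ⟨fun h => ⟨?_, ?_, ?_, ?_⟩, fun h => by rw [h.1, h.2.1, h.2.2.1, h.2.2.2]⟩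
  · exact congrFun h ![false, false]
  · exact congrFun h ![false, true]
  · exact congrFun h ![true, false]
  · exact congrFun h ![true, true]

theorem oct_inj {X : Type u} {a b c d a' b' c' d' p q r s p' q' r' s' : X} :
    oct a b c d a' b' c' d' = oct p q r s p' q' r' s' ↔
      (a = p ∧ b = q ∧ c = r ∧ d = s) ∧ a' = p' ∧ b' = q' ∧ c' = r' ∧ d' = s' := by
  rw [oct, oct, glue_inj, quad_inj, quad_inj]

theorem face_zero_false {X : Type u} (a b c d a' b' c' d' : X) :
    face 0 false (oct a b c d a' b' c' d') = quad a b c d := by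
  funext ε; rfl

theorem face_zero_true {X : Type u} (a b c d a' b' c' d' : X) :
    face 0 true (oct a b c d a' b' c' d') = quad a' b' c' d' := by
  funext ε; rfl

theorem face_one {X : Type u} (e : Bool) (a b c d a' b' c' d' : X) :
    face 1 e (oct a b c d a' b' c' d') =
      cond e (quad c d c' d') (quad a b a' b') := by
  funext ε
  have h0 : (Fin.insertNth (α := fun _ => Bool) (1 : Fin 3) e ε) 0 = ε 0 := rfl
  have h1 : (Fin.insertNth (α := fun _ => Bool) (1 : Fin 3) e ε) 1 = e := rfl
  have h2 : (Fin.insertNth (α := fun _ => Bool) (1 : Fin 3) e ε) 2 = ε 1 := rfl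
  cases e <;>
  · simp only [face, oct, glue, quad, Fin.succ_zero_eq_one, Fin.succ_one_eq_two, h0, h1, h2,
      cond]
    generalize ε 0 = b0
    generalize ε 1 = b1
    cases b0 <;> cases b1 <;> rfl

theorem face_two {X : Type u} (e : Bool) (a b c d a' b' c' d' : X) :
    face 2 e (oct a b c d a' b' c' d') =
      cond e (quad b d b' d') (quad a c a' c') := by
  funext ε
  have h0 : (Fin.insertNth (α := fun _ => Bool) (2 : Fin 3) e ε) 0 = ε 0 := rfl
  have h1 : (Fin.insertNth (α := fun _ => Bool) (2 : Fin 3) e ε) 1 = ε 1 := rfl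
  have h2 : (Fin.insertNth (α := fun _ => Bool) (2 : Fin 3) e ε) 2 = e := rfl
  cases e <;>
  · simp only [face, oct, glue, quad, Fin.succ_zero_eq_one, Fin.succ_one_eq_two, h0, h1, h2,
      cond]
    generalize ε 0 = b0
    generalize ε 1 = b1
    cases b0 <;> cases b1 <;> rfl

/-- The isometry of the cube that permutes the coordinates by `τ` and then reflects those
coordinates `j` for which `c j = true`. -/
def cubeIsometry {n : ℕ} (τ : Equiv.Perm (Fin n)) (c : Fin n → Bool) :
    Equiv.Perm (Fin n → Bool) where
  toFun ε j := xor (ε (τ j)) (c j)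
  invFun ε j := xor (ε (τ.symm j)) (c (τ.symm j))
  left_inv ε := by funext j; simp
  right_inv ε := by funext j; simp

theorem isEuclidean_cubeIsometry {n : ℕ} (τ : Equiv.Perm (Fin n)) (c : Fin n → Bool) :
    IsEuclidean (cubeIsometry τ c) := by
  intro a b
  unfold hammingDist cubeIsometry
  refine Finset.card_equiv τ fun j => ?_
  simp

theorem IsEuclidean.symm {n : ℕ} {σ : Equiv.Perm (Fin n → Bool)} (h : IsEuclidean σ) :
    IsEuclidean σ.symm := by
  intro a b
  rw [← h, Equiv.apply_symm_apply, Equiv.apply_symm_apply]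

/-! ### The base group of a parallelogram structure -/

/-- A weak parallelogram structure is pulled back from an abelian group, its base. -/
theorem IsWeakParallelogramStructure.exists_addCommGroup {X : Type u} [Nonempty X]
    {P : Set (Cube 2 X)} (h : IsWeakParallelogramStructure P) :
    ∃ (B : Type u) (_ : AddCommGroup B) (π : X → B), Function.Surjective π ∧
      ∀ a b c d : X, quad a b c d ∈ P ↔ π a + π d = π b + π c := by
  classical
  obtain ⟨i⟩ := ‹Nonempty X›
  have rfl' : ∀ a b, quad a b a b ∈ P := fun a b => h.equivalence.refl (a, b)
  have sym : ∀ {a b c d}, quad a b c d ∈ P → quad c d a b ∈ P := fun {a b c d} H =>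
    h.equivalence.symm (x := (a, b)) (y := (c, d)) H
  have tr : ∀ {a b c d e f}, quad a b c d ∈ P → quad c d e f ∈ P → quad a b e f ∈ P :=
    fun {a b c d e f} H H' => h.equivalence.trans (x := (a, b)) (y := (c, d)) (z := (e, f)) H H'
  have sw : ∀ {a b c d}, quad a b c d ∈ P → quad a c b d ∈ P := fun H => h.symmetry _ _ _ _ H
  have dg : ∀ a b, quad a a b b ∈ P := fun a b => sw (rfl' a b)
  -- The elements of the base are the fibres, that is, the classes of this relation; the sum of the
  -- fibres of `x` and `y` is the fibre of the point `c x y` that closes `(i, x, y)`.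
  let S : Setoid X :=
    { r := fun x y => quad i x i y ∈ P
      iseqv := ⟨fun x => rfl' _ _, fun H => sym H, fun H H' => tr H H'⟩ }
  choose c hc using h.closing i
  have key : ∀ {x y x' y' z z'}, quad i x i x' ∈ P → quad i y i y' ∈ P → quad i x y z ∈ P →
      quad i x' y' z' ∈ P → quad i z i z' ∈ P := by
    intro x y x' y' z z' H1 H2 H3 H4
    have h1 : quad y z i x' ∈ P := tr (sym H3) H1
    have h2 : quad y z y' z' ∈ P := tr h1 H4
    have h3 : quad i i y y' ∈ P := sw H2
    have h4 : quad y y' z z' ∈ P := sw h2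
    exact sw (tr h3 h4)
  let B := Quotient S
  let add : B → B → B := Quotient.map₂ c (fun x x' hx y y' hy => key hx hy (hc x y) (hc x' y'))
  have comm : ∀ a b : B, add a b = add b a := by
    rintro ⟨x⟩ ⟨y⟩
    exact Quotient.sound (key (rfl' _ _) (rfl' _ _) (hc x y) (sw (hc y x)))
  have uniq : ∀ {p q r s s'}, quad p q r s ∈ P → quad p q r s' ∈ P → quad i s i s' ∈ P := by
    intro p q r s s' H H'
    exact sw (tr (dg i r) (sw (tr (sym H) H')))
  have assoc : ∀ a b d : B, add (add a b) d = add a (add b d) := by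
    rintro ⟨x⟩ ⟨y⟩ ⟨z⟩
    refine Quotient.sound ?_
    change quad i (c (c x y) z) i (c x (c y z)) ∈ P
    have h1 : quad y (c y z) (c x y) (c (c x y) z) ∈ P :=
      tr (sym (sw (hc y z))) (sw (hc (c x y) z))
    have h2 : quad i x (c y z) (c (c x y) z) ∈ P := tr (hc x y) (sw h1)
    exact uniq h2 (hc x (c y z))
  have zero_add : ∀ a : B, add (Quotient.mk S i) a = a := by
    rintro ⟨x⟩
    exact Quotient.sound (uniq (hc i x) (dg i x))
  choose n hn using fun x => h.closing x i i
  have neg_add : ∀ x : X, add (Quotient.mk S (n x)) (Quotient.mk S x) = Quotient.mk S i := by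
    intro x
    refine Quotient.sound ?_
    change quad i (c (n x) x) i i ∈ P
    exact uniq (hc (n x) x) (sym (hn x))
  let _ : Add B := ⟨add⟩
  let _ : Zero B := ⟨Quotient.mk S i⟩
  let _ : Neg B := ⟨fun a => Quotient.mk S (n a.out)⟩
  have neg_add' : ∀ a : B, -a + a = 0 := fun a => by
    have := neg_add a.out
    rw [Quotient.out_eq] at this
    exact this
  let _ : AddCommGroup B :=
    { AddGroup.ofLeftAxioms assoc zero_add neg_add' with add_comm := comm }
  have mk_add : ∀ x y : X, Quotient.mk S x + Quotient.mk S y = Quotient.mk S (c x y) :=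
    fun x y => rfl
  refine ⟨B, inferInstance, Quotient.mk S, Quotient.mk_surjective, fun x y z w => ?_⟩
  rw [mk_add, mk_add]
  -- If `t` closes `(x, y, z)`, then `x + t = y + z` in the base.
  have add_eq : ∀ t, quad x y z t ∈ P → Quotient.mk S (c x t) = Quotient.mk S (c y z) := by
    intro t H
    refine Quotient.sound ?_
    change quad i (c x t) i (c y z) ∈ P
    have h1 : quad i x z (c x z) ∈ P := hc x z
    have h2 : quad i y z (c y z) ∈ P := hc y z
    have h3 : quad x y (c x z) (c y z) ∈ P := sw (tr (sym (sw h1)) (sw h2))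
    have h4 : quad z t (c x z) (c y z) ∈ P := tr (sym H) h3
    have h5 : quad i x t (c y z) ∈ P := tr h1 (sw h4)
    exact uniq (hc x t) h5
  refine ⟨add_eq w, fun H => ?_⟩
  -- Conversely, `w` is in the fibre of a point `t` that closes `(x, y, z)`.
  obtain ⟨t, ht⟩ := h.closing x y z
  have h1 := add_eq t ht
  have h2 : (Quotient.mk S w : B) = Quotient.mk S t := by
    have : (Quotient.mk S x : B) + Quotient.mk S w = Quotient.mk S x + Quotient.mk S t := by
      rw [mk_add, mk_add, H, h1]
    exact add_left_cancel this
  have h3 : quad i t i w ∈ P := Quotient.exact h2.symm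
  exact tr ht (sw (tr (dg z i) (sw h3)))

/-! ### Elements of a power of a group supported on a set of vertices -/

theorem place_mul {G : Type u} [Group G] {n : ℕ} (α : Set (Fin n → Bool)) (g h : G) :
    place α (g * h) = place α g * place α h := by
  classical
  funext ε
  by_cases hε : ε ∈ α <;> simp [place, hε]

theorem place_one {G : Type u} [Group G] {n : ℕ} (α : Set (Fin n → Bool)) :
    place α (1 : G) = 1 := by
  classical
  funext ε
  by_cases hε : ε ∈ α <;> simp [place, hε]

theorem place_inv {G : Type u} [Group G] {n : ℕ} (α : Set (Fin n → Bool)) (g : G) :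
    place α g⁻¹ = (place α g)⁻¹ := by
  classical
  funext ε
  by_cases hε : ε ∈ α <;> simp [place, hε]

theorem commutatorElement_place {G : Type u} [Group G] {n : ℕ} (α β : Set (Fin n → Bool))
    (g h : G) : ⁅place α g, place β h⁆ = place (α ∩ β) ⁅g, h⁆ := by
  classical
  funext ε
  by_cases hα : ε ∈ α <;> by_cases hβ : ε ∈ β <;>
    simp [place, hα, hβ, commutatorElement_def]

theorem place_union {G : Type u} [Group G] {n : ℕ} {α β : Set (Fin n → Bool)}
    (h : Disjoint α β) (g : G) : place (α ∪ β) g = place α g * place β g := by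
  classical
  funext ε
  by_cases hα : ε ∈ α
  · have hβ : ε ∉ β := Set.disjoint_left.mp h hα
    simp [place, hα, hβ]
  · by_cases hβ : ε ∈ β <;> simp [place, hα, hβ]

theorem place_comp {G : Type u} [Group G] {n : ℕ} (σ : Equiv.Perm (Fin n → Bool))
    (α : Set (Fin n → Bool)) (g : G) :
    (fun ε => place α g (σ ε)) = place (σ ⁻¹' α) g := by
  rfl

/-! ### Permutations of `X` that act on the edges or on the faces of the parallelepipeds -/

/-- The elements of `(Perm X)^[n]` that preserve a set `Q` of points of `X^[n]`. -/
def cubeStabilizer {X : Type u} {n : ℕ} (Q : Set (Cube n X)) :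
    Subgroup (Cube n (Equiv.Perm X)) where
  carrier := {h | ∀ x, (fun ε => h ε (x ε)) ∈ Q ↔ x ∈ Q}
  mul_mem' := fun {a b} ha hb x => (ha (fun ε => b ε (x ε))).trans (hb x)
  one_mem' := fun x => Iff.rfl
  inv_mem' := fun {a} ha x => by
    have := ha (fun ε => (a ε)⁻¹ (x ε))
    simpa using this.symm

theorem comp_mem_cubeStabilizer {X : Type u} {n : ℕ} {Q : Set (Cube n X)}
    (hQ : ∀ σ : Equiv.Perm (Fin n → Bool), IsEuclidean σ → ∀ x ∈ Q, (fun ε => x (σ ε)) ∈ Q)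
    {σ : Equiv.Perm (Fin n → Bool)} (hσ : IsEuclidean σ) {h : Cube n (Equiv.Perm X)}
    (hh : h ∈ cubeStabilizer Q) : (fun ε => h (σ ε)) ∈ cubeStabilizer Q := by
  have key : ∀ x, (fun ε => x (σ ε)) ∈ Q ↔ x ∈ Q := fun x =>
    ⟨fun H => by simpa using hQ σ.symm hσ.symm _ H, hQ σ hσ x⟩
  intro x
  have h1 := key (fun ε => h ε (x (σ.symm ε)))
  have h2 := hh (fun ε => x (σ.symm ε))
  have h3 := key (fun ε => x (σ.symm ε))
  simp only [Equiv.symm_apply_apply] at h1 h3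
  exact h1.trans (h2.trans h3.symm)

/-- The permutations of `X` whose action on any edge preserves `Q`. -/
def edgeTranslations {X : Type u} (Q : Set (Cube 3 X)) : Subgroup (Equiv.Perm X) where
  carrier := {u | ∀ a b : Fin 3 → Bool, hammingDist a b = 1 → place {a, b} u ∈ cubeStabilizer Q}
  mul_mem' := fun {u v} hu hv a b hab => by
    rw [place_mul]
    exact mul_mem (hu a b hab) (hv a b hab)
  one_mem' := fun a b _ => by
    rw [place_one]
    exact one_mem _
  inv_mem' := fun {u} hu a b hab => by
    rw [place_inv]
    exact inv_mem (hu a b hab)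

/-- The permutations of `X` whose action on any two dimensional face preserves `Q`. -/
def faceTranslations {X : Type u} (Q : Set (Cube 3 X)) : Subgroup (Equiv.Perm X) where
  carrier := {g | ∀ (i : Fin 3) (b : Bool), place {ε | ε i = b} g ∈ cubeStabilizer Q}
  mul_mem' := fun {u v} hu hv i b => by
    rw [place_mul]
    exact mul_mem (hu i b) (hv i b)
  one_mem' := fun i b => by
    rw [place_one]
    exact one_mem _
  inv_mem' := fun {u} hu i b => by
    rw [place_inv]
    exact inv_mem (hu i b)

/-- Every face is the disjoint union of two parallel edges. -/
theorem edgeTranslations_le_faceTranslations {X : Type u} (Q : Set (Cube 3 X)) :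
    edgeTranslations Q ≤ faceTranslations Q := by
  intro u hu i b
  have key : ∃ a a' c c' : Fin 3 → Bool, hammingDist a a' = 1 ∧ hammingDist c c' = 1 ∧
      Disjoint ({a, a'} : Finset (Fin 3 → Bool)) {c, c'} ∧
      ∀ ε : Fin 3 → Bool, ε i = b ↔ ε ∈ ({a, a'} : Finset _) ∪ {c, c'} := by
    have h1 : ∀ b : Bool, hammingDist ![b, false, false] ![b, false, true] = 1 ∧
        hammingDist ![b, true, false] ![b, true, true] = 1 ∧
        Disjoint ({![b, false, false], ![b, false, true]} : Finset (Fin 3 → Bool))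
          {![b, true, false], ![b, true, true]} ∧
        ∀ ε : Fin 3 → Bool, ε 0 = b ↔
          ε ∈ ({![b, false, false], ![b, false, true]} : Finset (Fin 3 → Bool)) ∪
            {![b, true, false], ![b, true, true]} := by decide
    have h2 : ∀ b : Bool, hammingDist ![false, b, false] ![false, b, true] = 1 ∧
        hammingDist ![true, b, false] ![true, b, true] = 1 ∧
        Disjoint ({![false, b, false], ![false, b, true]} : Finset (Fin 3 → Bool))
          {![true, b, false], ![true, b, true]} ∧
        ∀ ε : Fin 3 → Bool, ε 1 = b ↔
          ε ∈ ({![false, b, false], ![false, b, true]} : Finset (Fin 3 → Bool)) ∪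
            {![true, b, false], ![true, b, true]} := by decide
    have h3 : ∀ b : Bool, hammingDist ![false, false, b] ![false, true, b] = 1 ∧
        hammingDist ![true, false, b] ![true, true, b] = 1 ∧
        Disjoint ({![false, false, b], ![false, true, b]} : Finset (Fin 3 → Bool))
          {![true, false, b], ![true, true, b]} ∧
        ∀ ε : Fin 3 → Bool, ε 2 = b ↔
          ε ∈ ({![false, false, b], ![false, true, b]} : Finset (Fin 3 → Bool)) ∪
            {![true, false, b], ![true, true, b]} := by decide
    fin_cases i
    · exact ⟨_, _, _, _, h1 b⟩
    · exact ⟨_, _, _, _, h2 b⟩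
    · exact ⟨_, _, _, _, h3 b⟩
  obtain ⟨a, a', c, c', ha, hc, hd, he⟩ := key
  have hset : {ε : Fin 3 → Bool | ε i = b} = {a, a'} ∪ {c, c'} := by
    ext ε
    refine (he ε).trans ?_
    simp only [Finset.mem_union, Finset.mem_insert, Finset.mem_singleton, Set.mem_union,
      Set.mem_insert_iff, Set.mem_singleton_iff]
  have hd' : Disjoint ({a, a'} : Set (Fin 3 → Bool)) {c, c'} := by
    have := Finset.disjoint_coe.mpr hd
    simpa using this
  rw [hset, place_union hd']
  exact mul_mem (hu a a' ha) (hu c c' hc)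

/-- Every edge is the intersection of two faces. -/
theorem exists_face_inter_face (a b : Fin 3 → Bool) (h : hammingDist a b = 1) :
    ∃ i j : Fin 3, ({ε | ε i = a i} ∩ {ε | ε j = a j} : Set (Fin 3 → Bool)) = {a, b} := by
  have key : ∀ a b : Fin 3 → Bool, hammingDist a b = 1 →
      ∃ i j : Fin 3, ∀ ε : Fin 3 → Bool, (ε i = a i ∧ ε j = a j) ↔ (ε = a ∨ ε = b) := by
    decide
  obtain ⟨i, j, hij⟩ := key a b h
  exact ⟨i, j, Set.ext hij⟩

theorem commutatorElement_mem_edgeTranslations {X : Type u} {Q : Set (Cube 3 X)}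
    {g h : Equiv.Perm X} (hg : g ∈ faceTranslations Q) (hh : h ∈ faceTranslations Q) :
    ⁅g, h⁆ ∈ edgeTranslations Q := by
  intro a b hab
  obtain ⟨i, j, hij⟩ := exists_face_inter_face a b hab
  rw [← hij, ← commutatorElement_place, commutatorElement_def]
  exact mul_mem (mul_mem (mul_mem (hg i _) (hh j _)) (inv_mem (hg i _))) (inv_mem (hh j _))

/-- In the presence of reflections and permutations of coordinates, it is enough to test one
face. -/
theorem mem_faceTranslations_of_place {X : Type u} {Q : Set (Cube 3 X)}
    (hQ : ∀ σ : Equiv.Perm (Fin 3 → Bool), IsEuclidean σ → ∀ x ∈ Q, (fun ε => x (σ ε)) ∈ Q)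
    {g : Equiv.Perm X} (hg : place {ε | ε 0 = true} g ∈ cubeStabilizer Q) :
    g ∈ faceTranslations Q := by
  intro i b
  have := comp_mem_cubeStabilizer hQ
    (isEuclidean_cubeIsometry (Equiv.swap 0 i) (fun _ => !b)) hg
  rw [place_comp] at this
  convert this using 2
  ext ε
  simp only [Set.mem_ofPred_eq, Set.mem_preimage, cubeIsometry, Equiv.coe_fn_mk,
    Equiv.swap_apply_left]
  cases ε i <;> cases b <;> simp

/-- In the presence of reflections and permutations of coordinates, it is enough to test one
edge. -/
theorem mem_edgeTranslations_of_place {X : Type u} {Q : Set (Cube 3 X)}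
    (hQ : ∀ σ : Equiv.Perm (Fin 3 → Bool), IsEuclidean σ → ∀ x ∈ Q, (fun ε => x (σ ε)) ∈ Q)
    {u : Equiv.Perm X}
    (hu : place {ε : Fin 3 → Bool | ε 1 = true ∧ ε 2 = true} u ∈ cubeStabilizer Q) :
    u ∈ edgeTranslations Q := by
  intro a b hab
  have key : ∀ a b : Fin 3 → Bool, hammingDist a b = 1 → ∃ i : Fin 3, ∀ ε : Fin 3 → Bool,
      (ε = a ∨ ε = b) ↔ (xor (ε (Equiv.swap 0 i 1)) (!a (Equiv.swap 0 i 1)) = true ∧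
        xor (ε (Equiv.swap 0 i 2)) (!a (Equiv.swap 0 i 2)) = true) := by
    decide
  obtain ⟨i, hi⟩ := key a b hab
  have := comp_mem_cubeStabilizer hQ
    (isEuclidean_cubeIsometry (Equiv.swap 0 i) (fun j => !a (Equiv.swap 0 i j))) hu
  rw [place_comp] at this
  convert this using 2
  ext ε
  exact hi ε

theorem oct_swap_first {X : Type u} {Q : Set (Cube 3 X)}
    (hQ : ∀ σ : Equiv.Perm (Fin 3 → Bool), IsEuclidean σ → ∀ x ∈ Q, (fun ε => x (σ ε)) ∈ Q)
    {a b c d a' b' c' d' : X} (h : oct a b c d a' b' c' d' ∈ Q) :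
    oct a b a' b' c d c' d' ∈ Q := by
  have := hQ _ (isEuclidean_cubeIsometry (Equiv.swap 0 1) (fun _ => false)) _ h
  convert this using 1
  funext ε
  have h0 : cubeIsometry (Equiv.swap 0 1) (fun _ => false) ε 0 = ε 1 := by simp [cubeIsometry]
  have h1 : cubeIsometry (Equiv.swap 0 1) (fun _ => false) ε 1 = ε 0 := by simp [cubeIsometry]
  have h2 : cubeIsometry (Equiv.swap 0 1) (fun _ => false) ε 2 = ε 2 := by
    simp [cubeIsometry, Equiv.swap_apply_of_ne_of_ne]
  simp only [oct, glue, quad, Fin.succ_zero_eq_one, Fin.succ_one_eq_two, h0, h1, h2]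
  generalize ε 0 = b0
  generalize ε 1 = b1
  generalize ε 2 = b2
  cases b0 <;> cases b1 <;> cases b2 <;> rfl

theorem oct_swap_last {X : Type u} {Q : Set (Cube 3 X)}
    (hQ : ∀ σ : Equiv.Perm (Fin 3 → Bool), IsEuclidean σ → ∀ x ∈ Q, (fun ε => x (σ ε)) ∈ Q)
    {a b c d a' b' c' d' : X} (h : oct a b c d a' b' c' d' ∈ Q) :
    oct a c b d a' c' b' d' ∈ Q := by
  have := hQ _ (isEuclidean_cubeIsometry (Equiv.swap 1 2) (fun _ => false)) _ h
  convert this using 1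
  funext ε
  have h0 : cubeIsometry (Equiv.swap 1 2) (fun _ => false) ε 0 = ε 0 := by
    simp [cubeIsometry, Equiv.swap_apply_of_ne_of_ne]
  have h1 : cubeIsometry (Equiv.swap 1 2) (fun _ => false) ε 1 = ε 2 := by simp [cubeIsometry]
  have h2 : cubeIsometry (Equiv.swap 1 2) (fun _ => false) ε 2 = ε 1 := by simp [cubeIsometry]
  simp only [oct, glue, quad, Fin.succ_zero_eq_one, Fin.succ_one_eq_two, h0, h1, h2]
  generalize ε 0 = b0
  generalize ε 1 = b1
  generalize ε 2 = b2
  cases b0 <;> cases b1 <;> cases b2 <;> rfl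

/-! ### Translations of a strong parallelepiped structure -/

namespace IsStrongParallelepipedStructure

variable {X : Type u} {P : Set (Cube 2 X)} {Q : Set (Cube 3 X)}

theorem glue_self_mem (h : IsStrongParallelepipedStructure P Q) {x : Cube 2 X} (hx : x ∈ P) :
    glue x x ∈ Q :=
  h.equivalence.refl ⟨x, hx⟩

theorem faces_mem (h : IsStrongParallelepipedStructure P Q) {a b c d a' b' c' d' : X}
    (hx : oct a b c d a' b' c' d' ∈ Q) :
    quad a b c d ∈ P ∧ quad a' b' c' d' ∈ P ∧ quad a b a' b' ∈ P ∧ quad c d c' d' ∈ P ∧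
      quad a c a' c' ∈ P ∧ quad b d b' d' ∈ P := by
  refine ⟨?_, ?_, ?_, ?_, ?_, ?_⟩
  · simpa only [face_zero_false] using h.faces _ hx 0 false
  · simpa only [face_zero_true] using h.faces _ hx 0 true
  · simpa only [face_one, cond] using h.faces _ hx 1 false
  · simpa only [face_one, cond] using h.faces _ hx 1 true
  · simpa only [face_two, cond] using h.faces _ hx 2 false
  · simpa only [face_two, cond] using h.faces _ hx 2 true

theorem left_mem (h : IsStrongParallelepipedStructure P Q) {x y : Cube 2 X}
    (hx : glue x y ∈ Q) : x ∈ P := by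
  obtain ⟨a, b, c, d, rfl⟩ := exists_eq_quad x
  obtain ⟨a', b', c', d', rfl⟩ := exists_eq_quad y
  exact (h.faces_mem hx).1

theorem right_mem (h : IsStrongParallelepipedStructure P Q) {x y : Cube 2 X}
    (hx : glue x y ∈ Q) : y ∈ P := by
  obtain ⟨a, b, c, d, rfl⟩ := exists_eq_quad x
  obtain ⟨a', b', c', d', rfl⟩ := exists_eq_quad y
  exact (h.faces_mem hx).2.1

theorem glue_symm (h : IsStrongParallelepipedStructure P Q) {x y : Cube 2 X}
    (hx : glue x y ∈ Q) : glue y x ∈ Q :=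
  h.equivalence.symm (x := ⟨x, h.left_mem hx⟩) (y := ⟨y, h.right_mem hx⟩) hx

theorem glue_trans (h : IsStrongParallelepipedStructure P Q) {x y z : Cube 2 X}
    (hx : glue x y ∈ Q) (hy : glue y z ∈ Q) : glue x z ∈ Q :=
  h.equivalence.trans (x := ⟨x, h.left_mem hx⟩) (y := ⟨y, h.right_mem hx⟩)
    (z := ⟨z, h.right_mem hy⟩) hx hy

/-- Gluing two parallelepipeds along a face orthogonal to the second direction. -/
theorem glue_trans_second (h : IsStrongParallelepipedStructure P Q)
    {a b c d a' b' c' d' e f e' f' : X}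
    (hx : oct a b c d a' b' c' d' ∈ Q) (hy : oct c d e f c' d' e' f' ∈ Q) :
    oct a b e f a' b' e' f' ∈ Q :=
  oct_swap_first h.symmetries
    (h.glue_trans (oct_swap_first h.symmetries hx) (oct_swap_first h.symmetries hy))

/-- Gluing two parallelepipeds along a face orthogonal to the third direction. -/
theorem glue_trans_third (h : IsStrongParallelepipedStructure P Q)
    {a b c d a' b' c' d' e f e' f' : X}
    (hx : oct a b c d a' b' c' d' ∈ Q) (hy : oct b e d f b' e' d' f' ∈ Q) :
    oct a e c f a' e' c' f' ∈ Q :=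
  oct_swap_last h.symmetries
    (h.glue_trans_second (oct_swap_last h.symmetries hx) (oct_swap_last h.symmetries hy))

theorem eq_of_mem_of_mem (h : IsStrongParallelepipedStructure P Q) {a b c d a' b' c' y z : X}
    (hy : oct a b c d a' b' c' y ∈ Q) (hz : oct a b c d a' b' c' z ∈ Q) : y = z := by
  obtain ⟨h1, -, h3, -, h5, -⟩ := h.faces_mem hy
  exact h.unique a b c d a' b' c' h1 h5 h3 y z hy hz

theorem self_mem (h : IsStrongParallelepipedStructure P Q) (a b : X) : quad a b a b ∈ P :=
  h.parallelograms.equivalence.refl (a, b)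

theorem diag_mem (h : IsStrongParallelepipedStructure P Q) (a b : X) : quad a a b b ∈ P :=
  h.parallelograms.symmetry _ _ _ _ (h.self_mem a b)

theorem const_mem (h : IsStrongParallelepipedStructure P Q) (x : X) :
    oct x x x x x x x x ∈ Q :=
  h.glue_self_mem (h.self_mem x x)

/-- A permutation that acts on a single vertex and preserves `Q` is trivial, because the last
vertex of a parallelepiped is determined by the others. -/
theorem eq_one_of_place_vertex (h : IsStrongParallelepipedStructure P Q) {u : Equiv.Perm X}
    (hu : place {ε : Fin 3 → Bool | ε 0 = true ∧ ε 1 = true ∧ ε 2 = true} u ∈ cubeStabilizer Q) :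
    u = 1 := by
  classical
  ext x
  have h1 := (hu (oct x x x x x x x x)).mpr (h.const_mem x)
  have h2 : (fun ε => place {ε : Fin 3 → Bool | ε 0 = true ∧ ε 1 = true ∧ ε 2 = true} u ε
      (oct x x x x x x x x ε)) = oct x x x x x x x (u x) := by
    rw [apply_oct]
    simp [place]
  rw [h2] at h1
  exact h.eq_of_mem_of_mem h1 (h.const_mem x)

theorem commutatorElement_eq_one (h : IsStrongParallelepipedStructure P Q) {g u : Equiv.Perm X}
    (hg : g ∈ faceTranslations Q) (hu : u ∈ edgeTranslations Q) : ⁅g, u⁆ = 1 := by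
  -- The face `ε₁ = 1` and the edge `ε₂ = ε₃ = 1` meet in a vertex.
  refine h.eq_one_of_place_vertex ?_
  have hset : {ε : Fin 3 → Bool | ε 0 = true ∧ ε 1 = true ∧ ε 2 = true} =
      {ε : Fin 3 → Bool | ε 0 = true} ∩ {![false, true, true], ![true, true, true]} := by
    have : ∀ ε : Fin 3 → Bool, (ε 0 = true ∧ ε 1 = true ∧ ε 2 = true) ↔
      (ε 0 = true ∧ (ε = ![false, true, true] ∨ ε = ![true, true, true])) := by decide
    exact Set.ext this
  have hu' := hu ![false, true, true] ![true, true, true] (by decide)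
  rw [hset, ← commutatorElement_place, commutatorElement_def]
  exact mul_mem (mul_mem (mul_mem (hg 0 _) hu') (inv_mem (hg 0 _))) (inv_mem hu')

theorem mul_comm_of_mem (h : IsStrongParallelepipedStructure P Q) {g u : Equiv.Perm X}
    (hg : g ∈ faceTranslations Q) (hu : u ∈ edgeTranslations Q) : g * u = u * g :=
  commutatorElement_eq_one_iff_mul_comm.mp (h.commutatorElement_eq_one hg hu)

end IsStrongParallelepipedStructure

/-- The action of an edge translation on each edge of a spanning tree of the cube. -/
theorem edgeTranslations_apply {X : Type u} {Q : Set (Cube 3 X)} {u : Equiv.Perm X}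
    (hu : u ∈ edgeTranslations Q) {a b c d a' b' c' d' : X} :
    (oct (u a) b c d (u a') b' c' d' ∈ Q ↔ oct a b c d a' b' c' d' ∈ Q) ∧
    (oct a (u b) c d a' (u b') c' d' ∈ Q ↔ oct a b c d a' b' c' d' ∈ Q) ∧
    (oct a b (u c) d a' b' (u c') d' ∈ Q ↔ oct a b c d a' b' c' d' ∈ Q) ∧
    (oct a b c (u d) a' b' c' (u d') ∈ Q ↔ oct a b c d a' b' c' d' ∈ Q) ∧
    (oct a b c d (u a') (u b') c' d' ∈ Q ↔ oct a b c d a' b' c' d' ∈ Q) ∧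
    (oct a b c d a' b' (u c') (u d') ∈ Q ↔ oct a b c d a' b' c' d' ∈ Q) ∧
    (oct a b c d a' (u b') c' (u d') ∈ Q ↔ oct a b c d a' b' c' d' ∈ Q) := by
  refine ⟨?_, ?_, ?_, ?_, ?_, ?_, ?_⟩
  · have := hu ![false, false, false] ![true, false, false] (by decide) (oct a b c d a' b' c' d')
    rw [apply_oct] at this
    simpa [place] using this
  · have := hu ![false, false, true] ![true, false, true] (by decide) (oct a b c d a' b' c' d')
    rw [apply_oct] at this
    simpa [place] using this
  · have := hu ![false, true, false] ![true, true, false] (by decide) (oct a b c d a' b' c' d')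
    rw [apply_oct] at this
    simpa [place] using this
  · have := hu ![false, true, true] ![true, true, true] (by decide) (oct a b c d a' b' c' d')
    rw [apply_oct] at this
    simpa [place] using this
  · have := hu ![true, false, false] ![true, false, true] (by decide) (oct a b c d a' b' c' d')
    rw [apply_oct] at this
    simpa [place] using this
  · have := hu ![true, true, false] ![true, true, true] (by decide) (oct a b c d a' b' c' d')
    rw [apply_oct] at this
    simpa [place] using this
  · have := hu ![true, false, true] ![true, true, true] (by decide) (oct a b c d a' b' c' d')
    rw [apply_oct] at this
    simpa [place] using this

namespace IsStrongParallelepipedStructure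

variable {X : Type u} {P : Set (Cube 2 X)} {Q : Set (Cube 3 X)}

/-- Edge translations act freely. -/
theorem eq_one_of_apply_eq (h : IsStrongParallelepipedStructure P Q) {u : Equiv.Perm X}
    (hu : u ∈ edgeTranslations Q) {x : X} (hx : u x = x) : u = 1 := by
  ext y
  have h1 : oct x x x x y y y y ∈ Q :=
    oct_swap_first h.symmetries (h.glue_self_mem (h.diag_mem x y))
  have h2 := (edgeTranslations_apply hu).2.2.2.1.mpr h1
  rw [hx] at h2
  exact h.eq_of_mem_of_mem h2 h1

/-- Edge translations act transitively on the fibres of the projection to the base. For `y` in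
the fibre of `x`, the translation sends `z` to the point `w` for which
`(x, x, x, y, z, z, z, w)` is a parallelepiped; gluing shows that it acts on edges. -/
theorem exists_mem_edgeTranslations (h : IsStrongParallelepipedStructure P Q) {x y : X}
    (hxy : quad x x x y ∈ P) : ∃ u ∈ edgeTranslations Q, u x = y := by
  have step : ∀ {p q}, quad p p p q ∈ P → ∃ f : X → X, ∀ z, oct p p p q z z z (f z) ∈ Q :=
    fun {p q} H => ⟨_, fun z => (h.closing p p p q z z z H (h.diag_mem p z)
      (h.diag_mem p z)).choose_spec⟩
  have hyx : quad y y y x ∈ P := by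
    have h1 : quad x x y x ∈ P := h.parallelograms.symmetry _ _ _ _
      (h.parallelograms.equivalence.symm (x := (x, x)) (y := (x, y))
        (h.parallelograms.symmetry _ _ _ _ hxy))
    exact h.parallelograms.equivalence.trans (x := (y, y)) (y := (x, x)) (z := (y, x))
      (h.diag_mem y x) h1
  -- Such a map acts on the edge joining the vertices `011` and `111`.
  have edge : ∀ {p q} {f : X → X}, (∀ z, oct p p p q z z z (f z) ∈ Q) →
      ∀ {a b c d a' b' c' d'}, oct a b c d a' b' c' d' ∈ Q →
        oct a b c (f d) a' b' c' (f d') ∈ Q := by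
    intro p q f hf a b c d a' b' c' d' H
    have h1 : oct b b d d b' b' d' d' ∈ Q :=
      oct_swap_last h.symmetries (oct_swap_first h.symmetries
        (h.glue_self_mem (h.faces_mem H).2.2.2.2.2))
    have h2 : oct d d d (f d) d' d' d' (f d') ∈ Q := h.glue_trans (h.glue_symm (hf d)) (hf d')
    exact h.glue_trans_third H (h.glue_trans_second h1 h2)
  obtain ⟨f, hf⟩ := step hxy
  obtain ⟨g, hg⟩ := step hyx
  have hgf : ∀ z, g (f z) = z := by
    intro z
    have h1 := edge hg (hf z)
    have h2 : g y = x := h.eq_of_mem_of_mem (hg y) (h.glue_self_mem hyx)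
    rw [h2] at h1
    exact h.eq_of_mem_of_mem h1
      (oct_swap_first h.symmetries (h.glue_self_mem (h.diag_mem x z)))
  have hfx : f x = y := h.eq_of_mem_of_mem (hf x) (h.glue_self_mem hxy)
  have hfg : ∀ z, f (g z) = z := by
    intro z
    have h1 := edge hf (hg z)
    rw [hfx] at h1
    exact h.eq_of_mem_of_mem h1
      (oct_swap_first h.symmetries (h.glue_self_mem (h.diag_mem y z)))
  refine ⟨⟨f, g, hgf, hfg⟩, mem_edgeTranslations_of_place h.symmetries fun z => ?_, hfx⟩
  obtain ⟨a, b, c, d, a', b', c', d', rfl⟩ := exists_eq_oct z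
  rw [apply_oct]
  simp only [place]
  refine ⟨fun H => ?_, fun H => ?_⟩
  · have := edge hg (by simpa using H)
    simpa [hgf] using this
  · simpa using edge hf H

/-- Two points that close the same three points to a parallelogram differ by an edge translation. -/
theorem exists_edgeTranslation_of_quad (h : IsStrongParallelepipedStructure P Q)
    {a b c d d' : X} (hd : quad a b c d ∈ P) (hd' : quad a b c d' ∈ P) :
    ∃ u ∈ edgeTranslations Q, u d = d' := by
  refine h.exists_mem_edgeTranslations ?_
  have h1 : quad c d c d' ∈ P := h.parallelograms.equivalence.trans (x := (c, d)) (y := (a, b))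
    (z := (c, d')) (h.parallelograms.equivalence.symm (x := (a, b)) (y := (c, d)) hd) hd'
  exact h.parallelograms.symmetry _ _ _ _ (h.parallelograms.equivalence.trans (x := (d, d))
    (y := (c, c)) (z := (d, d')) (h.diag_mem d c) (h.parallelograms.symmetry _ _ _ _ h1))

/-- Moving the vertices of a parallelepiped within their fibres gives a parallelepiped if and only
if the alternating product of the displacements is trivial. -/
theorem oct_apply_mem_iff (h : IsStrongParallelepipedStructure P Q) {a b c d a' b' c' d' : X}
    (hQ : oct a b c d a' b' c' d' ∈ Q) (p q r s p' q' r' s' : edgeTranslations Q) :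
    oct (p.1 a) (q.1 b) (r.1 c) (s.1 d) (p'.1 a') (q'.1 b') (r'.1 c') (s'.1 d') ∈ Q ↔
      p * s * q' * r' = q * r * p' * s' := by
  let _ : CommGroup (edgeTranslations Q) :=
    { mul_comm := fun u v => Subtype.ext
        (h.mul_comm_of_mem (edgeTranslations_le_faceTranslations Q u.2) v.2) }
  -- The displacements are pushed along a spanning tree to the last vertex.
  have h1 := (edgeTranslations_apply p.2).1.mpr hQ
  have h2 := (edgeTranslations_apply (p' * p⁻¹).2).2.2.2.2.1.mpr h1
  have h3 := (edgeTranslations_apply q.2).2.1.mpr h2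
  have h4 := (edgeTranslations_apply (q' * p * p'⁻¹ * q⁻¹).2).2.2.2.2.2.2.mpr h3
  have h5 := (edgeTranslations_apply r.2).2.2.1.mpr h4
  have h6 := (edgeTranslations_apply (r' * r⁻¹).2).2.2.2.2.2.1.mpr h5
  have h7 := (edgeTranslations_apply s.2).2.2.2.1.mpr h6
  simp only [← Equiv.Perm.mul_apply, ← Subgroup.coe_mul] at h7
  have e1 : p' * p⁻¹ * p = p' := by simp
  have e2 : q' * p * p'⁻¹ * q⁻¹ * (q * (p' * p⁻¹)) = q' := by
    calc q' * p * p'⁻¹ * q⁻¹ * (q * (p' * p⁻¹))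
        = q' * (p * p⁻¹) * (p' * p'⁻¹) * (q * q⁻¹) := by ac_rfl
      _ = q' := by simp
  have e3 : r' * r⁻¹ * r = r' := by simp
  rw [e1, e2, e3] at h7
  have key : s' = s * (r' * r⁻¹ * (q' * p * p'⁻¹ * q⁻¹)) ↔ p * s * q' * r' = q * r * p' * s' := by
    have : q * r * p' * (s * (r' * r⁻¹ * (q' * p * p'⁻¹ * q⁻¹))) = p * s * q' * r' := by
      calc q * r * p' * (s * (r' * r⁻¹ * (q' * p * p'⁻¹ * q⁻¹)))
          = p * s * q' * r' * (q * q⁻¹) * (r * r⁻¹) * (p' * p'⁻¹) := by ac_rfl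
        _ = p * s * q' * r' := by simp
    rw [← this, mul_right_inj, eq_comm]
  rw [← key]
  refine ⟨fun H => ?_, fun H => ?_⟩
  · have e := h.eq_of_mem_of_mem H h7
    refine Subtype.ext (inv_mul_eq_one.mp (h.eq_one_of_apply_eq (x := d') ?_ ?_))
    · exact mul_mem (inv_mem (Subtype.prop _)) (Subtype.prop _)
    · rw [Equiv.Perm.mul_apply, ← e]
      simp
  · rw [H]
    exact h7

end IsStrongParallelepipedStructure

/-! ### Structures with a transitive group of translations -/

namespace IsStrongParallelepipedStructure

variable {X : Type u} {P : Set (Cube 2 X)} {Q : Set (Cube 3 X)}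

/-- A strong parallelepiped structure can be transported along a bijection. -/
theorem comap {Z : Type u} (h : IsStrongParallelepipedStructure P Q) (e : Z ≃ X) :
    IsStrongParallelepipedStructure {z : Cube 2 Z | (fun ε => e (z ε)) ∈ P}
      {z : Cube 3 Z | (fun ε => e (z ε)) ∈ Q} where
  parallelograms :=
    { equivalence := by
        have : ParRel {z : Cube 2 Z | (fun ε => e (z ε)) ∈ P} =
            fun p q => ParRel P (Prod.map e e p) (Prod.map e e q) := by
          funext p q
          simp only [ParRel, Set.mem_ofPred_eq, comp_quad, Prod.map_fst, Prod.map_snd]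
        rw [this]
        exact h.parallelograms.equivalence.comap _
      symmetry := fun a b c d H => by
        simp only [Set.mem_ofPred_eq, comp_quad] at H ⊢
        exact h.parallelograms.symmetry _ _ _ _ H
      closing := fun a b c => by
        obtain ⟨d, hd⟩ := h.parallelograms.closing (e a) (e b) (e c)
        exact ⟨e.symm d, by
          simpa only [Set.mem_ofPred_eq, comp_quad, e.apply_symm_apply] using hd⟩ }
  faces := fun x hx i b => h.faces _ hx i b
  symmetries := fun σ hσ x hx => h.symmetries σ hσ _ hx
  equivalence := by
    have := h.equivalence.comap
      (fun z : {z : Cube 2 Z | (fun ε => e (z ε)) ∈ P} => (⟨fun ε => e (z.1 ε), z.2⟩ : P))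
    refine ⟨fun x => ?_, fun {x y} hx => ?_, fun {x y z} hx hy => ?_⟩
    · simpa only [Set.mem_ofPred_eq, comp_glue] using this.refl x
    · simp only [Set.mem_ofPred_eq, comp_glue] at hx ⊢
      exact this.symm (x := x) (y := y) hx
    · simp only [Set.mem_ofPred_eq, comp_glue] at hx hy ⊢
      exact this.trans (x := x) (y := y) (z := z) hx hy
  closing := fun a b c d a' b' c' h1 h2 h3 => by
    simp only [Set.mem_ofPred_eq, comp_quad] at h1 h2 h3
    obtain ⟨d', hd'⟩ := h.closing _ _ _ _ _ _ _ h1 h2 h3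
    exact ⟨e.symm d', by simpa only [Set.mem_ofPred_eq, comp_oct, e.apply_symm_apply] using hd'⟩
  unique := fun a b c d a' b' c' h1 h2 h3 y z hy hz => by
    simp only [Set.mem_ofPred_eq, comp_quad, comp_oct] at h1 h2 h3 hy hz
    exact e.injective (h.unique _ _ _ _ _ _ _ h1 h2 h3 _ _ hy hz)

theorem apply_comm (h : IsStrongParallelepipedStructure P Q) {g u : Equiv.Perm X}
    (hg : g ∈ faceTranslations Q) (hu : u ∈ edgeTranslations Q) (x : X) : g (u x) = u (g x) :=
  DFunLike.congr_fun (h.mul_comm_of_mem hg hu) x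

/-- Face translations act on the sides of parallelograms. -/
theorem quad_apply_first (h : IsStrongParallelepipedStructure P Q) {g : Equiv.Perm X}
    (hg : g ∈ faceTranslations Q) {a b c d : X} :
    quad (g a) (g b) c d ∈ P ↔ quad a b c d ∈ P := by
  have key : ∀ {g : Equiv.Perm X}, g ∈ faceTranslations Q → ∀ {a b c d : X},
      quad a b c d ∈ P → quad (g a) (g b) c d ∈ P := by
    intro g hg a b c d H
    have h1 := (hg 1 false (oct a b c d a b c d)).mpr (h.glue_self_mem H)
    rw [apply_oct] at h1
    refine (h.faces_mem (a := g a) (b := g b) (c := c) (d := d) (a' := g a) (b' := g b) (c' := c)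
      (d' := d) ?_).1
    simpa [place] using h1
  exact ⟨fun H => by simpa using key (inv_mem hg) H, key hg⟩

theorem quad_apply_second (h : IsStrongParallelepipedStructure P Q) {g : Equiv.Perm X}
    (hg : g ∈ faceTranslations Q) {a b c d : X} :
    quad (g a) b (g c) d ∈ P ↔ quad a b c d ∈ P :=
  ⟨fun H => h.parallelograms.symmetry _ _ _ _
      ((h.quad_apply_first hg).mp (h.parallelograms.symmetry _ _ _ _ H)),
    fun H => h.parallelograms.symmetry _ _ _ _
      ((h.quad_apply_first hg).mpr (h.parallelograms.symmetry _ _ _ _ H))⟩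

theorem quad_apply_all (h : IsStrongParallelepipedStructure P Q) {g : Equiv.Perm X}
    (hg : g ∈ faceTranslations Q) {a b c d : X} :
    quad (g a) (g b) (g c) (g d) ∈ P ↔ quad a b c d ∈ P := by
  have sym : ∀ {a b c d}, quad a b c d ∈ P → quad c d a b ∈ P := fun {a b c d} H =>
    h.parallelograms.equivalence.symm (x := (a, b)) (y := (c, d)) H
  rw [h.quad_apply_first hg]
  exact ⟨fun H => sym ((h.quad_apply_first hg).mp (sym H)),
    fun H => sym ((h.quad_apply_first hg).mpr (sym H))⟩

/-- Edge translations act on the vertices of parallelograms. -/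
theorem quad_apply_vertices (h : IsStrongParallelepipedStructure P Q) {p q r s : Equiv.Perm X}
    (hp : p ∈ edgeTranslations Q) (hq : q ∈ edgeTranslations Q) (hr : r ∈ edgeTranslations Q)
    (hs : s ∈ edgeTranslations Q) {a b c d : X} (H : quad a b c d ∈ P) :
    quad (p a) (q b) (r c) (s d) ∈ P := by
  have h1 := (edgeTranslations_apply hp).1.mpr (h.glue_self_mem H)
  have h2 := (edgeTranslations_apply hq).2.1.mpr h1
  have h3 := (edgeTranslations_apply hr).2.2.1.mpr h2
  exact (h.faces_mem ((edgeTranslations_apply hs).2.2.2.1.mpr h3)).1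

theorem isNilTriple (h : IsStrongParallelepipedStructure P Q) (i : X) :
    IsNilTriple ((edgeTranslations Q).subgroupOf (faceTranslations Q))
      (MulAction.stabilizer (faceTranslations Q) i) where
  commutator_le := by
    rw [commutator_def, Subgroup.commutator_le]
    intro g _ g' _
    exact commutatorElement_mem_edgeTranslations g.2 g'.2
  le_center := by
    intro u hu
    rw [Subgroup.mem_center_iff]
    intro g
    exact Subtype.ext (h.mul_comm_of_mem g.2 hu)
  inf_eq_bot := by
    rw [eq_bot_iff]
    rintro u ⟨hu, hu'⟩
    exact Subtype.ext (h.eq_one_of_apply_eq hu' (MulAction.mem_stabilizer_iff.mp hu))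

theorem edgeGroup2_apply_mem (h : IsStrongParallelepipedStructure P Q)
    {k : Cube 2 (faceTranslations Q)} (hk : k ∈ edgeGroup2 (faceTranslations Q))
    {x : Cube 2 X} (hx : x ∈ P) : (fun ε => (k ε).1 (x ε)) ∈ P := by
  have key : edgeGroup2 (faceTranslations Q) ≤
      (cubeStabilizer P).comap ((faceTranslations Q).subtype.compLeft (Fin 2 → Bool)) := by
    rw [edgeGroup2, Subgroup.closure_le]
    rintro _ ⟨g, rfl | rfl | rfl⟩ x <;> obtain ⟨a, b, c, d, rfl⟩ := exists_eq_quad x <;>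
      rw [apply_quad]
    · exact h.quad_apply_first g.2
    · exact h.quad_apply_second g.2
    · exact h.quad_apply_all g.2
  exact (key hk x).mpr hx

theorem faceGroup3_apply_mem {k : Cube 3 (faceTranslations Q)}
    (hk : k ∈ faceGroup3 (faceTranslations Q)) {x : Cube 3 X} (hx : x ∈ Q) :
    (fun ε => (k ε).1 (x ε)) ∈ Q := by
  classical
  have key : faceGroup3 (faceTranslations Q) ≤
      (cubeStabilizer Q).comap ((faceTranslations Q).subtype.compLeft (Fin 3 → Bool)) := by
    rw [faceGroup3, Subgroup.closure_le]
    rintro _ ⟨g, i, b, rfl⟩ x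
    convert g.2 i b x using 6
    simp only [place, MonoidHom.compLeft_apply, Function.comp]
    split_ifs <;> rfl
  exact (key hk x).mpr hx

theorem edgeGroup3_apply_mem {k : Cube 3 (faceTranslations Q)}
    (hk : k ∈ edgeGroup3 ((edgeTranslations Q).subgroupOf (faceTranslations Q)))
    {x : Cube 3 X} (hx : x ∈ Q) : (fun ε => (k ε).1 (x ε)) ∈ Q := by
  classical
  have key : edgeGroup3 ((edgeTranslations Q).subgroupOf (faceTranslations Q)) ≤
      (cubeStabilizer Q).comap ((faceTranslations Q).subtype.compLeft (Fin 3 → Bool)) := by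
    rw [edgeGroup3, Subgroup.closure_le]
    rintro _ ⟨g, hg, a, b, hab, rfl⟩ x
    convert hg a b hab x using 6
    simp only [place, MonoidHom.compLeft_apply, Function.comp]
    split_ifs <;> rfl
  exact (key hk x).mpr hx

/-- If the face translations act transitively, the parallelograms are those of the quotient of the
group of face translations by a stabilizer. -/
theorem preimage_parallelograms_eq (h : IsStrongParallelepipedStructure P Q)
    (htrans : ∀ x y : X, ∃ g ∈ faceTranslations Q, g x = y) (i : X)
    (e : (faceTranslations Q) ⧸ MulAction.stabilizer (faceTranslations Q) i ≃ X)
    (he : ∀ g : faceTranslations Q, e (g : _ ⧸ _) = g.1 i) :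
    {z : Cube 2 ((faceTranslations Q) ⧸ MulAction.stabilizer (faceTranslations Q) i) |
      (fun ε => e (z ε)) ∈ P} =
    nilParallelograms ((edgeTranslations Q).subgroupOf (faceTranslations Q))
      (MulAction.stabilizer (faceTranslations Q) i) := by
  ext z
  refine ⟨fun hz => ?_, ?_⟩
  · obtain ⟨a, b, c, d, hx⟩ := exists_eq_quad (fun ε => e (z ε))
    rw [Set.mem_ofPred_eq, hx] at hz
    obtain ⟨g0, hg0, rfl⟩ := htrans i a
    obtain ⟨g1, hg1, rfl⟩ := htrans (g0 i) b
    obtain ⟨g2, hg2, rfl⟩ := htrans (g0 i) c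
    have h1 : quad (g0 i) (g1 (g0 i)) (g2 (g0 i)) (g1 (g2 (g0 i))) ∈ P :=
      h.parallelograms.symmetry _ _ _ _ (h.parallelograms.equivalence.symm
        (x := (g1 (g0 i), g1 (g2 (g0 i)))) (y := (g0 i, g2 (g0 i)))
        ((h.quad_apply_first hg1).mpr (h.self_mem _ _)))
    obtain ⟨u, hu, hud⟩ := h.exists_edgeTranslation_of_quad h1 hz
    let k0 : faceTranslations Q := ⟨g0, hg0⟩
    let k1 : faceTranslations Q := ⟨g1, hg1⟩
    let k2 : faceTranslations Q := ⟨g2, hg2⟩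
    let v : faceTranslations Q := ⟨u, edgeTranslations_le_faceTranslations Q hu⟩
    have gen : ∀ g : faceTranslations Q, quad g g 1 1 ∈ edgeGroup2 (faceTranslations Q) ∧
        quad g 1 g 1 ∈ edgeGroup2 (faceTranslations Q) ∧
        quad g g g g ∈ edgeGroup2 (faceTranslations Q) := fun g =>
      ⟨Subgroup.subset_closure ⟨g, Or.inl rfl⟩, Subgroup.subset_closure ⟨g, Or.inr (Or.inl rfl)⟩,
        Subgroup.subset_closure ⟨g, Or.inr (Or.inr rfl)⟩⟩
    refine ⟨_, Set.mul_mem_mul (mul_mem (mul_mem (mul_mem (gen k1).2.2 (gen k1⁻¹).2.1)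
      (mul_mem (gen k2).2.2 (gen k2⁻¹).1)) (gen k0).2.2) (?_ : quad 1 1 1 v ∈ _), ?_⟩
    · intro ε
      have : ∀ b0 b1 : Bool, quad 1 1 1 v ![b0, b1] ∈
          (edgeTranslations Q).subgroupOf (faceTranslations Q) := by
        intro b0 b1
        cases b0 <;> cases b1
        · exact one_mem _
        · exact one_mem _
        · exact one_mem _
        · exact hu
      have h : ε = ![ε 0, ε 1] := by ext i; fin_cases i <;> rfl
      rw [h]
      exact this _ _
    · funext ε
      refine e.injective ?_
      rw [he]
      revert ε
      rw [← funext_iff, hx]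
      refine (eq_quad _).trans (quad_inj.mpr ⟨?_, ?_, ?_, ?_⟩)
      · change (k1 * k1⁻¹ * (k2 * k2⁻¹) * k0 * 1).1 i = k0.1 i
        simp
      · change (k1 * 1 * (k2 * k2⁻¹) * k0 * 1).1 i = k1.1 (k0.1 i)
        simp
      · change (k1 * k1⁻¹ * (k2 * 1) * k0 * 1).1 i = k2.1 (k0.1 i)
        simp
      · change (k1 * 1 * (k2 * 1) * k0 * v).1 i = d
        simp only [mul_one]
        change g1 (g2 (g0 (u i))) = d
        rw [h.apply_comm hg0 hu, h.apply_comm hg2 hu, h.apply_comm hg1 hu, hud]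
  · rintro ⟨_, ⟨k, hk, f, hf, rfl⟩, rfl⟩
    simp only [Set.mem_ofPred_eq, he]
    refine h.edgeGroup2_apply_mem hk (x := fun ε => (f ε).1 i) ?_
    have h1 := h.quad_apply_vertices (hf ![false, false]) (hf ![false, true]) (hf ![true, false])
      (hf ![true, true]) (h.self_mem i i)
    have h2 := apply_quad (fun ε => (f ε).1) i i i i
    rw [← const_eq_quad] at h2
    rw [h2]
    exact h1

/-- If the face translations act transitively, the parallelepipeds are those of the quotient of the
group of face translations by a stabilizer. -/
theorem preimage_parallelepipeds_eq (h : IsStrongParallelepipedStructure P Q)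
    (htrans : ∀ x y : X, ∃ g ∈ faceTranslations Q, g x = y) (i : X)
    (e : (faceTranslations Q) ⧸ MulAction.stabilizer (faceTranslations Q) i ≃ X)
    (he : ∀ g : faceTranslations Q, e (g : _ ⧸ _) = g.1 i) :
    {z : Cube 3 ((faceTranslations Q) ⧸ MulAction.stabilizer (faceTranslations Q) i) |
      (fun ε => e (z ε)) ∈ Q} =
    nilParallelepipeds ((edgeTranslations Q).subgroupOf (faceTranslations Q))
      (MulAction.stabilizer (faceTranslations Q) i) := by
  ext z
  refine ⟨fun hz => ?_, ?_⟩
  · obtain ⟨a, b, c, d, a', b', c', d', hx⟩ := exists_eq_oct (fun ε => e (z ε))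
    rw [Set.mem_ofPred_eq, hx] at hz
    obtain ⟨g0, hg0, rfl⟩ := htrans i a
    obtain ⟨g1, hg1, rfl⟩ := htrans (g0 i) b
    obtain ⟨g2, hg2, rfl⟩ := htrans (g0 i) c
    obtain ⟨g3, hg3, rfl⟩ := htrans (g0 i) a'
    let k0 : faceTranslations Q := ⟨g0, hg0⟩
    let k1 : faceTranslations Q := ⟨g1, hg1⟩
    let k2 : faceTranslations Q := ⟨g2, hg2⟩
    let k3 : faceTranslations Q := ⟨g3, hg3⟩
    -- An element of the face group moves the base point to a parallelepiped with the prescribed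
    -- vertices `000`, `001`, `010`, `100`.
    have gen : ∀ (g : faceTranslations Q) (j : Fin 3) (e : Bool),
        place {ε | ε j = e} g ∈ faceGroup3 (faceTranslations Q) := fun g j e =>
      Subgroup.subset_closure ⟨g, j, e, rfl⟩
    let k : Cube 3 (faceTranslations Q) := place {ε | ε 0 = true} k3 * place {ε | ε 1 = true} k2 *
      place {ε | ε 2 = true} k1 * (place {ε | ε 0 = true} k0 * place {ε | ε 0 = false} k0)
    have hk : k ∈ faceGroup3 (faceTranslations Q) :=
      mul_mem (mul_mem (mul_mem (gen k3 _ _) (gen k2 _ _)) (gen k1 _ _))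
        (mul_mem (gen k0 _ _) (gen k0 _ _))
    have hk' : k = oct k0 (k1 * k0) (k2 * k0) (k2 * k1 * k0) (k3 * k0) (k3 * k1 * k0)
        (k3 * k2 * k0) (k3 * k2 * k1 * k0) := by
      refine (eq_oct k).trans (oct_inj.mpr ⟨⟨?_, ?_, ?_, ?_⟩, ?_, ?_, ?_, ?_⟩) <;>
        simp [k, place]
    have h1 := faceGroup3_apply_mem hk (h.const_mem i)
    rw [apply_oct, hk'] at h1
    change oct (g0 i) (g1 (g0 i)) (g2 (g0 i)) (g2 (g1 (g0 i))) (g3 (g0 i)) (g3 (g1 (g0 i)))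
      (g3 (g2 (g0 i))) (g3 (g2 (g1 (g0 i)))) ∈ Q at h1
    -- The vertices `011`, `101`, `110` are corrected within their fibres.
    obtain ⟨p1, -, p2, -, p3, -⟩ := h.faces_mem h1
    obtain ⟨q1, -, q2, -, q3, -⟩ := h.faces_mem hz
    obtain ⟨u, hu, rfl⟩ := h.exists_edgeTranslation_of_quad p1 q1
    obtain ⟨v, hv, rfl⟩ := h.exists_edgeTranslation_of_quad p2 q2
    obtain ⟨w, hw, rfl⟩ := h.exists_edgeTranslation_of_quad p3 q3
    have h2 := (edgeTranslations_apply hu).2.2.2.1.mpr h1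
    have h3 := (edgeTranslations_apply hv).2.2.2.2.2.2.mpr h2
    have h4 := (edgeTranslations_apply hw).2.2.2.2.2.1.mpr h3
    have h5 := h.eq_of_mem_of_mem h4 hz
    let u' : faceTranslations Q := ⟨u, edgeTranslations_le_faceTranslations Q hu⟩
    let v' : faceTranslations Q := ⟨v, edgeTranslations_le_faceTranslations Q hv⟩
    let w' : faceTranslations Q := ⟨w, edgeTranslations_le_faceTranslations Q hw⟩
    have gen' : ∀ (g : faceTranslations Q), g.1 ∈ edgeTranslations Q → ∀ a b : Fin 3 → Bool,
        hammingDist a b = 1 → place {a, b} g ∈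
          edgeGroup3 ((edgeTranslations Q).subgroupOf (faceTranslations Q)) := fun g hg a b hab =>
      Subgroup.subset_closure ⟨g, hg, a, b, hab, rfl⟩
    let f : Cube 3 (faceTranslations Q) := place {![true, true, false], ![true, true, true]} w' *
      place {![true, false, true], ![true, true, true]} v' *
      place {![false, true, true], ![true, true, true]} u'
    have hf : f ∈ edgeGroup3 ((edgeTranslations Q).subgroupOf (faceTranslations Q)) :=
      mul_mem (mul_mem (gen' w' hw _ _ (by decide)) (gen' v' hv _ _ (by decide)))
        (gen' u' hu _ _ (by decide))
    have hf' : f = oct 1 1 1 u' 1 v' w' (w' * v' * u') := by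
      refine (eq_oct f).trans (oct_inj.mpr ⟨⟨?_, ?_, ?_, ?_⟩, ?_, ?_, ?_, ?_⟩) <;>
        simp [f, place]
    refine ⟨_, Set.mul_mem_mul hk hf, ?_⟩
    funext ε
    refine e.injective ?_
    rw [he, hk', hf']
    revert ε
    rw [← funext_iff, hx]
    refine (eq_oct _).trans (oct_inj.mpr ⟨⟨?_, ?_, ?_, ?_⟩, ?_, ?_, ?_, ?_⟩)
    · rfl
    · rfl
    · rfl
    · change g2 (g1 (g0 (u i))) = u (g2 (g1 (g0 i)))
      rw [h.apply_comm hg0 hu, h.apply_comm hg1 hu, h.apply_comm hg2 hu]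
    · rfl
    · change g3 (g1 (g0 (v i))) = v (g3 (g1 (g0 i)))
      rw [h.apply_comm hg0 hv, h.apply_comm hg1 hv, h.apply_comm hg3 hv]
    · change g3 (g2 (g0 (w i))) = w (g3 (g2 (g0 i)))
      rw [h.apply_comm hg0 hw, h.apply_comm hg2 hw, h.apply_comm hg3 hw]
    · rw [← h5]
      change g3 (g2 (g1 (g0 (w (v (u i)))))) = w (v (u (g3 (g2 (g1 (g0 i))))))
      rw [h.apply_comm hg0 hw, h.apply_comm hg1 hw, h.apply_comm hg2 hw, h.apply_comm hg3 hw,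
        h.apply_comm hg0 hv, h.apply_comm hg1 hv, h.apply_comm hg2 hv, h.apply_comm hg3 hv,
        h.apply_comm hg0 hu, h.apply_comm hg1 hu, h.apply_comm hg2 hu, h.apply_comm hg3 hu]
  · rintro ⟨_, ⟨k, hk, f, hf, rfl⟩, rfl⟩
    simp only [Set.mem_ofPred_eq, he]
    refine faceGroup3_apply_mem hk (x := fun ε => (f ε).1 i) ?_
    refine edgeGroup3_apply_mem hf (x := fun _ => i) ?_
    rw [const_eq_oct]
    exact h.const_mem i

/-- A strong parallelepiped structure with a transitive group of face translations is a
nilparallelepiped structure. -/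
theorem exists_isNilParallelepipedStructure [Nonempty X]
    (h : IsStrongParallelepipedStructure P Q)
    (htrans : ∀ x y : X, ∃ g ∈ faceTranslations Q, g x = y) :
    ∃ (G : Type u) (_ : Group G) (F Γ : Subgroup G) (e : G ⧸ Γ ≃ X),
      IsNilParallelepipedStructure F Γ {z : Cube 2 (G ⧸ Γ) | (fun ε => e (z ε)) ∈ P}
        {z : Cube 3 (G ⧸ Γ) | (fun ε => e (z ε)) ∈ Q} := by
  obtain ⟨i⟩ := ‹Nonempty X›
  let e : (faceTranslations Q) ⧸ MulAction.stabilizer (faceTranslations Q) i ≃ X :=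
    Equiv.ofBijective (MulAction.ofQuotientStabilizer (faceTranslations Q) i)
      ⟨MulAction.injective_ofQuotientStabilizer _ i, fun x => by
        obtain ⟨g, hg, rfl⟩ := htrans i x
        exact ⟨((⟨g, hg⟩ : faceTranslations Q) : _ ⧸ _), rfl⟩⟩
  have he : ∀ g : faceTranslations Q, e (g : _ ⧸ _) = g.1 i := fun g => rfl
  exact ⟨faceTranslations Q, inferInstance, (edgeTranslations Q).subgroupOf (faceTranslations Q),
    MulAction.stabilizer (faceTranslations Q) i, e, h.isNilTriple i,
    h.preimage_parallelograms_eq htrans i e he, h.preimage_parallelepipeds_eq htrans i e he,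
    h.comap e⟩

end IsStrongParallelepipedStructure

/-! ### Alternating sums and coordinates -/

/-- The alternating sum of a point of `F^[3]`: the value at `ε` is counted with the sign
`(-1)^|ε|`. -/
def altSum {F : Type u} [AddCommGroup F] (f : Cube 3 F) : F :=
  ∑ ε, (-1 : ℤ) ^ hammingDist ε (fun _ => false) • f ε

theorem altSum_oct {F : Type u} [AddCommGroup F] (a b c d a' b' c' d' : F) :
    altSum (oct a b c d a' b' c' d') = a - b - c + d - a' + b' + c' - d' := by
  have huniv : (Finset.univ : Finset (Fin 3 → Bool)) =
      {![false, false, false], ![false, false, true], ![false, true, false],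
        ![false, true, true], ![true, false, false], ![true, false, true],
        ![true, true, false], ![true, true, true]} := by
    decide
  have d0 : hammingDist ![false, false, false] (fun _ => false) = 0 := by decide
  have d1 : hammingDist ![false, false, true] (fun _ => false) = 1 := by decide
  have d2 : hammingDist ![false, true, false] (fun _ => false) = 1 := by decide
  have d3 : hammingDist ![false, true, true] (fun _ => false) = 2 := by decide
  have d4 : hammingDist ![true, false, false] (fun _ => false) = 1 := by decide
  have d5 : hammingDist ![true, false, true] (fun _ => false) = 2 := by decide
  have d6 : hammingDist ![true, true, false] (fun _ => false) = 2 := by decide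
  have d7 : hammingDist ![true, true, true] (fun _ => false) = 3 := by decide
  rw [altSum, huniv]
  rw [Finset.sum_insert (by decide), Finset.sum_insert (by decide), Finset.sum_insert (by decide),
    Finset.sum_insert (by decide), Finset.sum_insert (by decide), Finset.sum_insert (by decide),
    Finset.sum_insert (by decide), Finset.sum_singleton, d0, d1, d2, d3, d4, d5, d6, d7]
  change (-1 : ℤ) ^ 0 • a + ((-1 : ℤ) ^ 1 • b + ((-1 : ℤ) ^ 1 • c + ((-1 : ℤ) ^ 2 • d +
    ((-1 : ℤ) ^ 1 • a' + ((-1 : ℤ) ^ 2 • b' + ((-1 : ℤ) ^ 2 • c' + (-1 : ℤ) ^ 3 • d')))))) = _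
  norm_num
  abel

/-- Isometries of the cube multiply alternating sums by a sign. -/
theorem altSum_comp {F : Type u} [AddCommGroup F] {σ : Equiv.Perm (Fin 3 → Bool)}
    (hσ : IsEuclidean σ) (f : Cube 3 F) :
    altSum (fun ε => f (σ ε)) =
      (-1 : ℤ) ^ hammingDist (σ fun _ => false) (fun _ => false) • altSum f := by
  have key : ∀ a b : Fin 3 → Bool, (-1 : ℤ) ^ hammingDist a b =
      (-1) ^ hammingDist b (fun _ => false) * (-1) ^ hammingDist a (fun _ => false) := by
    decide
  rw [altSum, altSum, ← Equiv.sum_comp σ (fun ε => (-1 : ℤ) ^ hammingDist ε (fun _ => false) • f ε),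
    Finset.smul_sum]
  refine Finset.sum_congr rfl fun ε _ => ?_
  rw [smul_smul, ← key, hσ]

theorem altSum_glue_self {F : Type u} [AddCommGroup F] (f : Cube 2 F) :
    altSum (glue f f) = 0 := by
  obtain ⟨a, b, c, d, rfl⟩ := exists_eq_quad f
  refine (altSum_oct a b c d a b c d).trans ?_
  abel

theorem altSum_glue_swap {F : Type u} [AddCommGroup F] (f g : Cube 2 F) :
    altSum (glue g f) = -altSum (glue f g) := by
  obtain ⟨a, b, c, d, rfl⟩ := exists_eq_quad f
  obtain ⟨a', b', c', d', rfl⟩ := exists_eq_quad g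
  refine (altSum_oct _ _ _ _ _ _ _ _).trans (Eq.trans ?_
    (congrArg _ (altSum_oct _ _ _ _ _ _ _ _).symm))
  abel

theorem altSum_glue_add {F : Type u} [AddCommGroup F] (f g k : Cube 2 F) :
    altSum (glue f k) = altSum (glue f g) + altSum (glue g k) := by
  obtain ⟨a, b, c, d, rfl⟩ := exists_eq_quad f
  obtain ⟨a', b', c', d', rfl⟩ := exists_eq_quad g
  obtain ⟨a'', b'', c'', d'', rfl⟩ := exists_eq_quad k
  refine (altSum_oct _ _ _ _ _ _ _ _).trans (Eq.trans ?_ (congrArg₂ _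
    (altSum_oct _ _ _ _ _ _ _ _).symm (altSum_oct _ _ _ _ _ _ _ _).symm))
  abel

/-- Every abelian group embeds in an injective one: a power of `ℚ / ℤ`. -/
theorem exists_injective_baer (A : Type u) [AddCommGroup A] :
    ∃ (F : Type u) (_ : AddCommGroup F) (j : A →+ F), Function.Injective j ∧ Module.Baer ℤ F := by
  refine ⟨CharacterModule A → AddCircle (1 : ℚ), inferInstance,
    AddMonoidHom.pi fun c : CharacterModule A => (c : A →+ AddCircle (1 : ℚ)), ?_,
    Module.Baer.of_divisible _⟩
  rw [injective_iff_map_eq_zero]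
  intro a ha
  exact CharacterModule.eq_zero_of_character_apply fun c => congrFun ha c

/-- Coordinates for a parallelepiped structure on `X`: a point `x` is determined by its projection
`π x` to the base and by its fibre coordinate `α x`, the parallelograms are pulled back from the
base, and parallelepipeds with the same projection to the base are those with the same alternating
sum of fibre coordinates. -/
structure IsCoordinateSystem {X B F : Type u} [AddCommGroup B] [AddCommGroup F]
    (P : Set (Cube 2 X)) (Q : Set (Cube 3 X)) (π : X → B) (α : X → F) : Prop where
  surjective : Function.Surjective π
  quad_mem_iff : ∀ a b c d : X, quad a b c d ∈ P ↔ π a + π d = π b + π c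
  injective : ∀ x y : X, π x = π y → α x = α y → x = y
  mem_iff : ∀ x ∈ Q, ∀ y : Cube 3 X, (fun ε => π (x ε)) = (fun ε => π (y ε)) →
    (y ∈ Q ↔ altSum (fun ε => α (x ε)) = altSum (fun ε => α (y ε)))

/-- The fibre coordinate of `x` is the edge translation that moves a chosen point of the fibre
to `x`. -/
theorem IsStrongParallelepipedStructure.exists_isCoordinateSystem {X : Type u} [Nonempty X]
    {P : Set (Cube 2 X)} {Q : Set (Cube 3 X)} (h : IsStrongParallelepipedStructure P Q) :
    ∃ (B F : Type u) (_ : AddCommGroup B) (_ : AddCommGroup F) (π : X → B) (α : X → F),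
      Module.Baer ℤ F ∧ IsCoordinateSystem P Q π α := by
  obtain ⟨B, _, π, hπ, hP⟩ := h.parallelograms.exists_addCommGroup
  let _ : CommGroup (edgeTranslations Q) :=
    { mul_comm := fun u v => Subtype.ext
        (h.mul_comm_of_mem (edgeTranslations_le_faceTranslations Q u.2) v.2) }
  obtain ⟨F, _, j, hj, hF⟩ := exists_injective_baer (Additive (edgeTranslations Q))
  have hu : ∀ x, ∃ u : edgeTranslations Q, u.1 (Function.surjInv hπ (π x)) = x := by
    intro x
    obtain ⟨u, hu, hux⟩ := h.exists_mem_edgeTranslations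
      (x := Function.surjInv hπ (π x)) (y := x) (by rw [hP, Function.surjInv_eq hπ])
    exact ⟨⟨u, hu⟩, hux⟩
  choose u hu using hu
  refine ⟨B, F, inferInstance, inferInstance, π, fun x => j (Additive.ofMul (u x)), hF, hπ, hP,
    fun x y hxy hα => ?_, fun x hx y hxy => ?_⟩
  · rw [← hu x, ← hu y, hxy, Additive.ofMul.injective (hj hα)]
  · obtain ⟨a, b, c, d, a', b', c', d', rfl⟩ := exists_eq_oct x
    obtain ⟨p, q, r, s, p', q', r', s', rfl⟩ := exists_eq_oct y
    rw [comp_oct, comp_oct, oct_inj] at hxy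
    obtain ⟨⟨e1, e2, e3, e4⟩, e5, e6, e7, e8⟩ := hxy
    have move : ∀ {x y : X}, π x = π y → (u y * (u x)⁻¹).1 x = y := by
      intro x y hxy
      have h1 : (u x).1⁻¹ x = Function.surjInv hπ (π x) := by
        rw [Equiv.Perm.inv_eq_iff_eq]
        exact (hu x).symm
      change (u y).1 ((u x).1⁻¹ x) = y
      rw [h1, hxy, hu y]
    have key := h.oct_apply_mem_iff hx (u p * (u a)⁻¹) (u q * (u b)⁻¹) (u r * (u c)⁻¹)
      (u s * (u d)⁻¹) (u p' * (u a')⁻¹) (u q' * (u b')⁻¹) (u r' * (u c')⁻¹) (u s' * (u d')⁻¹)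
    rw [move e1, move e2, move e3, move e4, move e5, move e6, move e7, move e8] at key
    rw [key, comp_oct (fun x => j (Additive.ofMul (u x))),
      comp_oct (fun x => j (Additive.ofMul (u x))), altSum_oct, altSum_oct,
      ← Additive.ofMul.injective.eq_iff,
      ← hj.eq_iff]
    simp only [ofMul_mul, ofMul_inv, map_add, map_neg]
    constructor <;> intro H <;> grind

/-! ### The extension with injective fibres -/

/-- The parallelograms of `B × F`: those whose projection to `B` is a parallelogram. -/
def prodParallelograms (B F : Type u) [AddCommGroup B] : Set (Cube 2 (B × F)) :=
  {z | (z ![false, false]).1 + (z ![true, true]).1 = (z ![false, true]).1 + (z ![true, false]).1}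

/-- The parallelepipeds of `B × F` that extend the set `Q` of parallelepipeds of `X` in the
coordinates `π`, `α`: those that have the same projection to the base and the same alternating sum
of fibre coordinates as some element of `Q`. -/
def prodParallelepipeds {X B F : Type u} [AddCommGroup F] (Q : Set (Cube 3 X)) (π : X → B)
    (α : X → F) : Set (Cube 3 (B × F)) :=
  {z | ∃ x ∈ Q, (fun ε => π (x ε)) = (fun ε => (z ε).1) ∧
    altSum (fun ε => α (x ε)) = altSum (fun ε => (z ε).2)}

theorem quad_mem_prodParallelograms {B F : Type u} [AddCommGroup B] {a b c d : B × F} :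
    quad a b c d ∈ prodParallelograms B F ↔ a.1 + d.1 = b.1 + c.1 :=
  Iff.rfl

theorem isWeakParallelogramStructure_prod (B F : Type u) [AddCommGroup B] [AddCommGroup F] :
    IsWeakParallelogramStructure (prodParallelograms B F) where
  equivalence := by
    refine ⟨fun x => ?_, fun {x y} h => ?_, fun {x y z} h h' => ?_⟩ <;>
      simp only [ParRel, quad_mem_prodParallelograms] at * <;> grind
  symmetry := fun a b c d h => by
    rw [quad_mem_prodParallelograms] at *
    rw [h, add_comm]
  closing := fun a b c => ⟨(b.1 + c.1 - a.1, 0), by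
    rw [quad_mem_prodParallelograms]
    dsimp only
    abel⟩

/-- Changing the fibre coordinates without changing their alternating sum. -/
theorem prodParallelepipeds_of_eq {X B F : Type u} [AddCommGroup F] {Q : Set (Cube 3 X)}
    {π : X → B} {α : X → F} {z z' : Cube 3 (B × F)} (hz : z ∈ prodParallelepipeds Q π α)
    (h1 : (fun ε => (z ε).1) = (fun ε => (z' ε).1))
    (h2 : altSum (fun ε => (z ε).2) = altSum (fun ε => (z' ε).2)) :
    z' ∈ prodParallelepipeds Q π α := by
  obtain ⟨x, hx, e1, e2⟩ := hz
  exact ⟨x, hx, e1.trans h1, e2.trans h2⟩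

theorem fst_glue {B F : Type u} {n : ℕ} (z z' : Cube n (B × F)) :
    (fun ε => (glue z z' ε).1) = glue (fun ε => (z ε).1) (fun ε => (z' ε).1) :=
  comp_glue Prod.fst z z'

theorem snd_glue {B F : Type u} {n : ℕ} (z z' : Cube n (B × F)) :
    (fun ε => (glue z z' ε).2) = glue (fun ε => (z ε).2) (fun ε => (z' ε).2) :=
  comp_glue Prod.snd z z'

theorem glue_symm_prod {X B F : Type u} [AddCommGroup F] {P : Set (Cube 2 X)}
    {Q : Set (Cube 3 X)} {π : X → B} {α : X → F}
    (h : IsStrongParallelepipedStructure P Q) {z z' : Cube 2 (B × F)}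
    (hz : glue z z' ∈ prodParallelepipeds Q π α) : glue z' z ∈ prodParallelepipeds Q π α := by
  obtain ⟨x, hx, e1, e2⟩ := hz
  obtain ⟨y, y', rfl⟩ := exists_eq_glue x
  rw [comp_glue, fst_glue, glue_inj] at e1
  rw [comp_glue, snd_glue] at e2
  refine ⟨glue y' y, h.glue_symm hx, ?_, ?_⟩
  · rw [comp_glue, fst_glue, e1.1, e1.2]
  · rw [comp_glue, snd_glue, altSum_glue_swap, e2, ← altSum_glue_swap]

namespace IsCoordinateSystem

variable {X B F : Type u} [AddCommGroup B] [AddCommGroup F] {P : Set (Cube 2 X)}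
  {Q : Set (Cube 3 X)} {π : X → B} {α : X → F}

theorem altSum_eq (hc : IsCoordinateSystem P Q π α) {z : Cube 3 (B × F)}
    (hz : z ∈ prodParallelepipeds Q π α) {y : Cube 3 X} (hy : y ∈ Q)
    (h1 : (fun ε => π (y ε)) = (fun ε => (z ε).1)) :
    altSum (fun ε => α (y ε)) = altSum (fun ε => (z ε).2) := by
  obtain ⟨x, hx, e1, e2⟩ := hz
  rw [← e2]
  exact ((hc.mem_iff x hx y (e1.trans h1.symm)).mp hy).symm

theorem mem_iff_proj (hc : IsCoordinateSystem P Q π α) {x : Cube 2 X} {z : Cube 2 (B × F)}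
    (h : (fun ε => π (x ε)) = (fun ε => (z ε).1)) : x ∈ P ↔ z ∈ prodParallelograms B F := by
  have e : ∀ ε, π (x ε) = (z ε).1 := congrFun h
  rw [eq_quad x, hc.quad_mem_iff, e, e, e, e]
  rfl

theorem exists_lift (hc : IsCoordinateSystem P Q π α) {n : ℕ} (b : Cube n B) :
    ∃ x : Cube n X, (fun ε => π (x ε)) = b := by
  choose s hs using hc.surjective
  exact ⟨fun ε => s (b ε), funext fun ε => hs _⟩

/-- The first half of a parallelepiped can be moved within its fibres. -/
theorem exists_glue_mem (hc : IsCoordinateSystem P Q π α)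
    (h : IsStrongParallelepipedStructure P Q) {x y y' : Cube 2 X} (hy : glue y y' ∈ Q)
    (hxy : (fun ε => π (x ε)) = (fun ε => π (y ε))) :
    ∃ w : Cube 2 X, (fun ε => π (w ε)) = (fun ε => π (y' ε)) ∧ glue x w ∈ Q := by
  obtain ⟨a, b, c, d, rfl⟩ := exists_eq_quad x
  obtain ⟨p, q, r, s, rfl⟩ := exists_eq_quad y
  obtain ⟨p', q', r', s', rfl⟩ := exists_eq_quad y'
  rw [comp_quad, comp_quad, quad_inj] at hxy
  obtain ⟨e1, e2, e3, e4⟩ := hxy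
  obtain ⟨h1, h2, h3, h4, h5, h6⟩ := h.faces_mem hy
  rw [hc.quad_mem_iff] at h1 h2 h3 h4 h5 h6
  obtain ⟨w, hw⟩ := h.closing a b c d p' q' r' (by rw [hc.quad_mem_iff, e1, e2, e3, e4, h1])
    (by rw [hc.quad_mem_iff, e1, e3, h5]) (by rw [hc.quad_mem_iff, e1, e2, h3])
  refine ⟨quad p' q' r' w, ?_, hw⟩
  have h7 := (h.faces_mem hw).2.1
  rw [hc.quad_mem_iff, ← h2] at h7
  rw [comp_quad, comp_quad, quad_inj]
  exact ⟨rfl, rfl, rfl, add_left_cancel h7⟩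

theorem glue_self_mem_prod (hc : IsCoordinateSystem P Q π α)
    (h : IsStrongParallelepipedStructure P Q) {z : Cube 2 (B × F)}
    (hz : z ∈ prodParallelograms B F) : glue z z ∈ prodParallelepipeds Q π α := by
  obtain ⟨x, hx⟩ := hc.exists_lift (fun ε => (z ε).1)
  refine ⟨glue x x, h.glue_self_mem ((hc.mem_iff_proj hx).mpr hz), ?_, ?_⟩
  · rw [comp_glue, fst_glue, hx]
  · rw [comp_glue, snd_glue, altSum_glue_self, altSum_glue_self]

theorem glue_trans_prod (hc : IsCoordinateSystem P Q π α)
    (h : IsStrongParallelepipedStructure P Q) {z z' z'' : Cube 2 (B × F)}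
    (hz : glue z z' ∈ prodParallelepipeds Q π α) (hz' : glue z' z'' ∈ prodParallelepipeds Q π α) :
    glue z z'' ∈ prodParallelepipeds Q π α := by
  obtain ⟨x, hx, e1, e2⟩ := hz
  obtain ⟨x1, x2, rfl⟩ := exists_eq_glue x
  obtain ⟨y, hy, e3, -⟩ := id hz'
  obtain ⟨y2, y3, rfl⟩ := exists_eq_glue y
  rw [comp_glue, fst_glue, glue_inj] at e1 e3
  obtain ⟨w, hw, hw'⟩ := hc.exists_glue_mem h hy (e1.2.trans e3.1.symm)
  have e4 := hc.altSum_eq hz' hw' (by rw [comp_glue, fst_glue, e1.2, hw, e3.2])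
  rw [comp_glue, snd_glue] at e2 e4
  refine ⟨glue x1 w, h.glue_trans hx hw', ?_, ?_⟩
  · rw [comp_glue, fst_glue, e1.1, hw, e3.2]
  · rw [comp_glue, snd_glue, altSum_glue_add (fun ε => α (x1 ε)) (fun ε => α (x2 ε)),
      altSum_glue_add (fun ε => (z ε).2) (fun ε => (z' ε).2), e2, e4]

theorem face_mem_prod (hc : IsCoordinateSystem P Q π α)
    (h : IsStrongParallelepipedStructure P Q) {z : Cube 3 (B × F)}
    (hz : z ∈ prodParallelepipeds Q π α) (i : Fin 3) (b : Bool) :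
    face i b z ∈ prodParallelograms B F := by
  obtain ⟨x, hx, e1, -⟩ := hz
  refine (hc.mem_iff_proj (x := face i b x) ?_).mp (h.faces x hx i b)
  funext ε
  exact congrFun e1 _

/-- The extension of a strong parallelepiped structure is a strong parallelepiped structure. -/
theorem isStrong_prod (hc : IsCoordinateSystem P Q π α)
    (h : IsStrongParallelepipedStructure P Q) :
    IsStrongParallelepipedStructure (prodParallelograms B F) (prodParallelepipeds Q π α) where
  parallelograms := isWeakParallelogramStructure_prod B F
  faces := fun z hz i b => hc.face_mem_prod h hz i b
  symmetries := by
    rintro σ hσ z ⟨x, hx, e1, e2⟩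
    refine ⟨_, h.symmetries σ hσ x hx, funext fun ε => congrFun e1 (σ ε), ?_⟩
    rw [altSum_comp hσ (fun ε => α (x ε)), altSum_comp hσ (fun ε => (z ε).2), e2]
  equivalence := ⟨fun z => hc.glue_self_mem_prod h z.2, fun hz => glue_symm_prod h hz,
    fun hz hz' => hc.glue_trans_prod h hz hz'⟩
  closing := by
    intro a b c d a' b' c' h1 h2 h3
    choose s hs using hc.surjective
    rw [quad_mem_prodParallelograms] at h1 h2 h3
    obtain ⟨w, hw⟩ := h.closing (s a.1) (s b.1) (s c.1) (s d.1) (s a'.1) (s b'.1) (s c'.1)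
      (by simp only [hc.quad_mem_iff, hs, h1]) (by simp only [hc.quad_mem_iff, hs, h2])
      (by simp only [hc.quad_mem_iff, hs, h3])
    refine ⟨(π w, a.2 - b.2 - c.2 + d.2 - a'.2 + b'.2 + c'.2 -
      altSum (oct (α (s a.1)) (α (s b.1)) (α (s c.1)) (α (s d.1)) (α (s a'.1)) (α (s b'.1))
        (α (s c'.1)) (α w))), _, hw, ?_, ?_⟩
    · rw [comp_oct, comp_oct Prod.fst]
      simp only [hs]
    · rw [comp_oct, comp_oct Prod.snd, altSum_oct _ _ _ _ _ _ _ (Prod.snd _)]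
      dsimp only
      abel
  unique := by
    intro a b c d a' b' c' h1 h2 h3 y z hy hz
    have e : y.1 = z.1 := by
      have k1 := hc.face_mem_prod h hy 0 true
      have k2 := hc.face_mem_prod h hz 0 true
      rw [face_zero_true, quad_mem_prodParallelograms] at k1 k2
      exact add_left_cancel (k1.trans k2.symm)
    obtain ⟨x, hx, e1, e2⟩ := hy
    have e3 := hc.altSum_eq hz hx (by rw [e1, comp_oct Prod.fst, comp_oct Prod.fst, e])
    have e4 := e2.symm.trans e3
    rw [comp_oct Prod.snd, comp_oct Prod.snd, altSum_oct, altSum_oct] at e4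
    exact Prod.ext e (sub_right_injective e4)

/-- A strong parallelepiped structure embeds in its extension. -/
theorem isParallelepipedEmbedding (hc : IsCoordinateSystem P Q π α)
    (h : IsStrongParallelepipedStructure P Q) :
    IsParallelepipedEmbedding P Q (prodParallelograms B F) (prodParallelepipeds Q π α)
      (fun x => (π x, α x)) := by
  have hmem : ∀ x : Cube 3 X,
      x ∈ Q ↔ (fun ε => (π (x ε), α (x ε))) ∈ prodParallelepipeds Q π α := by
    refine fun x => ⟨fun hx => ⟨x, hx, rfl, rfl⟩, ?_⟩
    rintro ⟨y, hy, e1, e2⟩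
    exact (hc.mem_iff y hy x e1).mpr e2
  refine ⟨fun x y hxy => ?_, fun x => hc.mem_iff_proj rfl, hmem, ?_, ?_⟩
  · exact hc.injective x y (congrArg Prod.fst hxy) (congrArg Prod.snd hxy)
  · rintro i ⟨p⟩
    obtain ⟨x, hx⟩ := hc.surjective (i.1 + p.2.1 - p.1.1)
    refine ⟨_, ⟨x, rfl⟩, Quot.sound ?_⟩
    change quad _ _ _ _ ∈ _
    rw [quad_mem_prodParallelograms]
    dsimp only
    rw [hx]
    abel
  · intro z hz hY
    obtain ⟨a, b, c, d, a', b', c', d', rfl⟩ := exists_eq_oct z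
    obtain ⟨p, hp⟩ : a ∈ Set.range fun x => (π x, α x) := hY ![false, false, false] (by decide)
    obtain ⟨q, hq⟩ : b ∈ Set.range fun x => (π x, α x) := hY ![false, false, true] (by decide)
    obtain ⟨r, hr⟩ : c ∈ Set.range fun x => (π x, α x) := hY ![false, true, false] (by decide)
    obtain ⟨s, hs⟩ : d ∈ Set.range fun x => (π x, α x) := hY ![false, true, true] (by decide)
    obtain ⟨p', hp'⟩ : a' ∈ Set.range fun x => (π x, α x) := hY ![true, false, false] (by decide)
    obtain ⟨q', hq'⟩ : b' ∈ Set.range fun x => (π x, α x) := hY ![true, false, true] (by decide)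
    obtain ⟨r', hr'⟩ : c' ∈ Set.range fun x => (π x, α x) := hY ![true, true, false] (by decide)
    subst hp hq hr hs hp' hq' hr'
    obtain ⟨h1, -, h3, -, h5, -⟩ := (hc.isStrong_prod h).faces_mem hz
    obtain ⟨w, hw⟩ := h.closing p q r s p' q' r' ((hc.quad_mem_iff _ _ _ _).mpr h1)
      ((hc.quad_mem_iff _ _ _ _).mpr h5) ((hc.quad_mem_iff _ _ _ _).mpr h3)
    have h8 := (hmem _).mp hw
    rw [comp_oct (fun x => (π x, α x))] at h8
    exact ⟨w, (hc.isStrong_prod h).eq_of_mem_of_mem h8 hz⟩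

end IsCoordinateSystem
/-- Embeddings can be transported along a bijection of the ambient set. -/
theorem IsParallelepipedEmbedding.comap {X Y Z : Type u} {P : Set (Cube 2 X)} {Q : Set (Cube 3 X)}
    {P' : Set (Cube 2 Y)} {Q' : Set (Cube 3 Y)} {φ : X → Y}
    (h : IsParallelepipedEmbedding P Q P' Q' φ) (e : Z ≃ Y) :
    IsParallelepipedEmbedding P Q {z : Cube 2 Z | (fun ε => e (z ε)) ∈ P'}
      {z : Cube 3 Z | (fun ε => e (z ε)) ∈ Q'} (fun x => e.symm (φ x)) where
  injective := e.symm.injective.comp h.injective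
  map_parallelograms := fun x => by
    simpa only [Set.mem_ofPred_eq, e.apply_symm_apply] using h.map_parallelograms x
  map_parallelepipeds := fun x => by
    simpa only [Set.mem_ofPred_eq, e.apply_symm_apply] using h.map_parallelepipeds x
  base_onto := by
    rintro i ⟨p⟩
    obtain ⟨_, ⟨x, rfl⟩, hx⟩ := h.base_onto (e i) (Quot.mk _ (e p.1, e p.2))
    refine ⟨_, ⟨x, rfl⟩, ?_⟩
    let f : Base P' → Base {z : Cube 2 Z | (fun ε => e (z ε)) ∈ P'} :=
      Quot.map (Prod.map e.symm e.symm) fun q r hqr => by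
        simpa only [ParRel, Set.mem_ofPred_eq, comp_quad, Prod.map_fst, Prod.map_snd,
          e.apply_symm_apply] using hqr
    have := congrArg f hx
    change Quot.mk _ (e.symm (e i), e.symm (φ x)) =
      Quot.mk _ (e.symm (e p.1), e.symm (e p.2)) at this
    simp only [e.symm_apply_apply] at this
    exact this
  closed := fun z hz hY => by
    obtain ⟨x, hx⟩ := h.closed _ hz fun ε hε => by
      obtain ⟨x, hx⟩ := hY ε hε
      exact ⟨x, by rw [← hx, e.apply_symm_apply]⟩
    exact ⟨x, e.symm_apply_eq.mpr hx⟩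

/-! ### Lifting translations of the base -/

namespace IsCoordinateSystem

variable {X B F : Type u} [AddCommGroup B] [AddCommGroup F] {P : Set (Cube 2 X)}
  {Q : Set (Cube 3 X)} {π : X → B} {α : X → F}

/-- The obstruction to lifting the translation by `b` of the base is a parallelogram structure on
`B × F`: the quadruples whose fibre coordinates compensate the alternating sum prescribed for the
parallelepipeds with faces `c` and `c + b`. -/
def shiftParallelograms (Q : Set (Cube 3 X)) (π : X → B) (α : X → F) (b : B) :
    Set (Cube 2 (B × F)) :=
  {z | glue (fun ε => ((z ε).1, (0 : F))) (fun ε => ((z ε).1 + b, (z ε).2)) ∈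
    prodParallelepipeds Q π α}

theorem quad_mem_shiftParallelograms {b : B} {p q r s : B × F} :
    quad p q r s ∈ shiftParallelograms Q π α b ↔
      oct (p.1, 0) (q.1, 0) (r.1, 0) (s.1, 0) (p.1 + b, p.2) (q.1 + b, q.2) (r.1 + b, r.2)
        (s.1 + b, s.2) ∈ prodParallelepipeds Q π α := by
  rw [shiftParallelograms, Set.mem_ofPred_eq, comp_quad (fun z : B × F => (z.1, (0 : F))),
    comp_quad (fun z : B × F => (z.1 + b, z.2))]
  rfl

theorem isWeakParallelogramStructure_shift (hc : IsCoordinateSystem P Q π α)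
    (h : IsStrongParallelepipedStructure P Q) (b : B) :
    IsWeakParallelogramStructure (shiftParallelograms Q π α b) := by
  have hs := hc.isStrong_prod h
  refine ⟨?_, fun p q r s H => ?_, fun p q r => ?_⟩
  -- After exchanging the first two directions of the cube, the relation is the pull-back of the
  -- equivalence relation on the parallelograms of `B × F`.
  · let W : (B × F) × (B × F) → prodParallelograms B F := fun p =>
      ⟨quad (p.1.1, 0) (p.2.1, 0) (p.1.1 + b, p.1.2) (p.2.1 + b, p.2.2), by
        rw [quad_mem_prodParallelograms]
        dsimp only
        abel⟩
    have : ParRel (shiftParallelograms Q π α b) =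
        fun p q => glue (W p).1 (W q).1 ∈ prodParallelepipeds Q π α := by
      funext p q
      rw [ParRel, quad_mem_shiftParallelograms]
      exact propext ⟨fun H => oct_swap_first hs.symmetries H,
        fun H => oct_swap_first hs.symmetries H⟩
    rw [this]
    exact hs.equivalence.comap W
  · rw [quad_mem_shiftParallelograms] at *
    exact oct_swap_last hs.symmetries H
  · obtain ⟨t, ht⟩ := hs.closing (p.1, 0) (q.1, 0) (r.1, 0) (q.1 + r.1 - p.1, 0) (p.1 + b, p.2)
      (q.1 + b, q.2) (r.1 + b, r.2) (by
        rw [quad_mem_prodParallelograms]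
        dsimp only
        abel) (by
        rw [quad_mem_prodParallelograms]
        dsimp only
        abel) (by
        rw [quad_mem_prodParallelograms]
        dsimp only
        abel)
    refine ⟨(q.1 + r.1 - p.1, t.2), ?_⟩
    have h1 := (hs.faces_mem ht).2.1
    rw [quad_mem_prodParallelograms] at h1
    have h2 : t = (q.1 + r.1 - p.1 + b, t.2) := by
      refine Prod.ext ?_ rfl
      dsimp only at h1 ⊢
      grind
    rw [quad_mem_shiftParallelograms]
    rw [h2] at ht
    exact ht

/-- Translating the fibre coordinates of one side by the same amount. -/
theorem quad_add_mem_shift (hc : IsCoordinateSystem P Q π α)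
    (h : IsStrongParallelepipedStructure P Q) (b : B) (p q : B × F) (v : F) :
    quad p (p.1, p.2 + v) q (q.1, q.2 + v) ∈ shiftParallelograms Q π α b := by
  have hs := hc.isStrong_prod h
  rw [quad_mem_shiftParallelograms]
  have h1 : quad (p.1, (0 : F)) (q.1, 0) (p.1 + b, p.2) (q.1 + b, q.2) ∈
      prodParallelograms B F := by
    rw [quad_mem_prodParallelograms]
    dsimp only
    abel
  have h2 := oct_swap_last hs.symmetries (oct_swap_first hs.symmetries (hs.glue_self_mem h1))
  refine prodParallelepipeds_of_eq h2 ?_ ?_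
  · rw [comp_oct Prod.fst, comp_oct Prod.fst]
  · rw [comp_oct Prod.snd, comp_oct Prod.snd, altSum_oct, altSum_oct]
    dsimp only
    abel

theorem eq_zero_of_quad_mem_shift (hc : IsCoordinateSystem P Q π α)
    (h : IsStrongParallelepipedStructure P Q) {b : B} {p : B × F} {v : F}
    (hv : quad p p p (p.1, p.2 + v) ∈ shiftParallelograms Q π α b) : v = 0 := by
  have h1 := hc.quad_add_mem_shift h b p p 0
  rw [add_zero] at h1
  rw [quad_mem_shiftParallelograms] at hv h1
  have h2 := congrArg Prod.snd ((hc.isStrong_prod h).eq_of_mem_of_mem hv h1)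
  simpa using h2

/-- If the fibre group is injective, translations of the base lift: the parallelogram structure
attached to `b` has a base `E`, which is an extension of `B` by `F`. A retraction `E → F` provides
the fibre coordinate `φ` of the lift. -/
theorem exists_lift_translation (hc : IsCoordinateSystem P Q π α)
    (h : IsStrongParallelepipedStructure P Q) (hF : Module.Baer ℤ F) (b : B) :
    ∃ φ : B → F, ∀ z ∈ prodParallelograms B F,
      glue z (fun ε => ((z ε).1 + b, (z ε).2 + φ (z ε).1)) ∈ prodParallelepipeds Q π α := by
  have hs := hc.isStrong_prod h
  have hw := hc.isWeakParallelogramStructure_shift h b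
  obtain ⟨E, _, θ, -, hθ⟩ := hw.exists_addCommGroup
  -- Adding `v` to the fibre coordinate changes `θ` by an element `ι v` that does not depend on the
  -- point, and `ι` embeds `F` in `E`.
  have hadd : ∀ p q : B × F, ∀ v : F, θ (p.1, p.2 + v) - θ p = θ (q.1, q.2 + v) - θ q := by
    intro p q v
    have := (hθ _ _ _ _).mp (hc.quad_add_mem_shift h b p q v)
    grind
  let ι : F →+ E := AddMonoidHom.mk' (fun v => θ (0, v) - θ (0, 0)) fun v w => by
    have h1 := hadd (0, v) (0, 0) w
    simp only [zero_add] at h1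
    grind
  have hι : ∀ (c : B) (f : F), θ (c, f) = θ (c, 0) + ι f := by
    intro c f
    have h1 := hadd (c, 0) (0, 0) f
    simp only [zero_add] at h1
    change _ = _ + (θ (0, f) - θ (0, 0))
    rw [← h1]
    abel
  have hinj : Function.Injective ι := by
    rw [injective_iff_map_eq_zero]
    intro v hv
    refine hc.eq_zero_of_quad_mem_shift h (b := b) (p := (0, 0)) ((hθ _ _ _ _).mpr ?_)
    dsimp only
    rw [zero_add, hι 0 v, hv, add_zero]
  obtain ⟨r, hr⟩ := hF.extension_property_addMonoidHom ι hinj (AddMonoidHom.id F)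
  have hrι : ∀ v, r (ι v) = v := fun v => DFunLike.congr_fun hr v
  let φ : B → F := fun c => -r (θ (c, 0))
  have hφ : ∀ c f, r (θ (c, f)) = f - φ c := by
    intro c f
    rw [hι, map_add, hrι]
    simp only [φ]
    abel
  refine ⟨φ, fun z hz => ?_⟩
  -- The point that closes three points of the graph of `φ` is again on the graph, by applying `r`.
  obtain ⟨p, q, s, t, rfl⟩ := exists_eq_quad z
  rw [quad_mem_prodParallelograms] at hz
  obtain ⟨⟨t1, t2⟩, ht⟩ := hw.closing (p.1, φ p.1) (q.1, φ q.1) (s.1, φ s.1)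
  have h1 := congrArg r ((hθ _ _ _ _).mp ht)
  simp only [map_add, hφ, sub_self, zero_add, sub_eq_zero] at h1
  rw [quad_mem_shiftParallelograms] at ht
  have h2 := (hs.faces_mem ht).1
  rw [quad_mem_prodParallelograms] at h2
  have h3 : t1 = t.1 := add_left_cancel (h2.trans hz.symm)
  subst h3
  rw [h1] at ht
  rw [comp_quad (fun z : B × F => (z.1 + b, z.2 + φ z.1))]
  change oct _ _ _ _ _ _ _ _ ∈ _
  refine prodParallelepipeds_of_eq ht ?_ ?_
  · rw [comp_oct Prod.fst, comp_oct Prod.fst]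
  · rw [comp_oct Prod.snd, comp_oct Prod.snd, altSum_oct, altSum_oct]
    dsimp only
    abel

/-- If the fibre group is injective, the face translations of the extension act transitively. -/
theorem exists_faceTranslation (hc : IsCoordinateSystem P Q π α)
    (h : IsStrongParallelepipedStructure P Q) (hF : Module.Baer ℤ F) (x y : B × F) :
    ∃ g ∈ faceTranslations (prodParallelepipeds Q π α), g x = y := by
  have hs := hc.isStrong_prod h
  obtain ⟨φ, hφ⟩ := hc.exists_lift_translation h hF (y.1 - x.1)
  -- The lift is composed with a translation of the fibres.
  let v : F := y.2 - x.2 - φ x.1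
  let g : Equiv.Perm (B × F) :=
    { toFun := fun z => (z.1 + (y.1 - x.1), z.2 + (φ z.1 + v))
      invFun := fun z => (z.1 - (y.1 - x.1), z.2 - (φ (z.1 - (y.1 - x.1)) + v))
      left_inv := fun z => by simp
      right_inv := fun z => by simp }
  have hg : ∀ z ∈ prodParallelograms B F,
      glue z (fun ε => g (z ε)) ∈ prodParallelepipeds Q π α := by
    intro z hz
    have h1 := hφ z hz
    obtain ⟨p, q, s, t, rfl⟩ := exists_eq_quad z
    rw [comp_quad (fun z : B × F => (z.1 + (y.1 - x.1), z.2 + φ z.1))] at h1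
    rw [comp_quad]
    change oct _ _ _ _ _ _ _ _ ∈ _ at h1
    change oct _ _ _ _ _ _ _ _ ∈ _
    refine prodParallelepipeds_of_eq h1 ?_ ?_
    · rw [comp_oct Prod.fst, comp_oct Prod.fst]
      rfl
    · rw [comp_oct Prod.snd, comp_oct Prod.snd, altSum_oct, altSum_oct]
      simp only [g, Equiv.coe_fn_mk]
      abel
  refine ⟨g, mem_faceTranslations_of_place hs.symmetries fun z => ?_, ?_⟩
  · obtain ⟨z', z'', rfl⟩ := exists_eq_glue z
    have e : (fun ε => place {ε : Fin 3 → Bool | ε 0 = true} g ε (glue z' z'' ε)) =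
        glue z' (fun ε => g (z'' ε)) := by
      funext ε
      by_cases hε : ε 0 = true <;> simp [place, glue, hε]
    rw [e]
    refine ⟨fun H => ?_, fun H => hs.glue_trans H (hg z'' (hs.right_mem H))⟩
    have h1 : z'' ∈ prodParallelograms B F := by
      have h2 := hs.right_mem H
      obtain ⟨p, q, s, t, rfl⟩ := exists_eq_quad z''
      rw [comp_quad, quad_mem_prodParallelograms] at h2
      rw [quad_mem_prodParallelograms]
      simp only [g, Equiv.coe_fn_mk] at h2
      grind
    exact hs.glue_trans H (hs.glue_symm (hg z'' h1))
  · simp only [g, Equiv.coe_fn_mk, v]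
    ext
    · simp
    · simp

end IsCoordinateSystem

end HKPar

theorem mainTheorem3 {X : Type u} [Nonempty X]
    (P : Set (HKPar.Cube 2 X)) (Q : Set (HKPar.Cube 3 X))
    (hPQ : HKPar.IsStrongParallelepipedStructure P Q) :
    ∃ (G : Type u) (_ : Group G) (F Γ : Subgroup G)
      (P' : Set (HKPar.Cube 2 (G ⧸ Γ))) (Q' : Set (HKPar.Cube 3 (G ⧸ Γ))),
      HKPar.IsNilParallelepipedStructure F Γ P' Q' ∧
      ∃ φ : X → G ⧸ Γ, HKPar.IsParallelepipedEmbedding P Q P' Q' φ := by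
  obtain ⟨B, F, _, _, π, α, hF, hc⟩ := hPQ.exists_isCoordinateSystem
  obtain ⟨G, _, F', Γ, e, he⟩ := (hc.isStrong_prod hPQ).exists_isNilParallelepipedStructure
    (hc.exists_faceTranslation hPQ hF)
  exact ⟨G, inferInstance, F', Γ, _, _, he, _, (hc.isParallelepipedEmbedding hPQ).comap e⟩
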